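/- Let $N\ge 0$ be an integer and $\omega=(\omega_1,\dots,\omega_N)\in\mathbb R^N$. For $0\le a\le b\le N$ put $\omega_{ab}=\omega_{a+1}\omega_{a+2}\cdots\omega_b$ (so $\omega_{aa}=1$). Let $e_{ab}$ ($0\le a,b\le N$) be the matrix units of size $N+1$. The special unitary Cayley–Klein algebra $su_\omega(N+1)$ is the real Lie algebra of complex matrices with basis $$J_{ab}=-\omega_{ab}e_{ab}+e_{ba},\qquad M_{ab}=i(\omega_{ab}e_{ab}+e_{ba})\quad(0\le a<b\le N),\qquad B_l=i(e_{l-1,l-1}-e_{ll})\quad(1\le l\le N).$$ Its brackets are the following relations (R), in which $a<b<c$, \begin{align*} &[J_{ab},J_{ac}]=\omega_{ab}J_{bc}, && [J_{ab},J_{bc}]=-J_{ac}, && [J_{ac},J_{bc}]=\omega_{bc}J_{ab},\\ &[M_{ab},M_{ac}]=\omega_{ab}J_{bc}, && [M_{ab},M_{bc}]=J_{ac}, && [M_{ac},M_{bc}]=\omega_{bc}J_{ab},\\ &[J_{ab},M_{ac}]=\omega_{ab}M_{bc}, && [J_{ab},M_{bc}]=-M_{ac}, && [J_{ac},M_{bc}]=-\omega_{bc}M_{ab},\\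 &[M_{ab},J_{ac}]=-\omega_{ab}M_{bc}, && [M_{ab},J_{bc}]=-M_{ac}, && [M_{ac},J_{bc}]=\omega_{bc}M_{ab}, \end{align*} $[J_{ab},J_{de}]=[M_{ab},M_{de}]=[J_{ab},M_{de}]=0$ for $a<b$, $d<e$ and $a,b,d,e$ all different, and, for $a<b$, $$[J_{ab},B_l]=(\delta_{a,l-1}-\delta_{b,l-1}+\delta_{bl}-\delta_{al})M_{ab},\qquad [M_{ab},B_l]=-(\delta_{a,l-1}-\delta_{b,l-1}+\delta_{bl}-\delta_{al})J_{ab},$$ together with $[J_{ab},M_{ab}]=-2\omega_{ab}\sum_{s=a+1}^bB_s$ and $[B_k,B_l]=0$. A central extension of $su_\omega(N+1)$ is a short exact sequence $0\to\mathbb R\,\Xi\to\overline{\mathcal G}\to su_\omega(N+1)\to0$ of real Lie algebras, with $\Xi\neq 0$ central in $\overline{\mathcal G}$. It is trivial if it splits, that is, if its two-cocycle is a coboundary. Two central extensions are equivalent if there is a Lie algebra isomorphism between them that is compatible with the projections to $su_\omega(N+1)$ and sends $\Xi$ to $\Xi$. For real numbers $\alpha_k$ ($1\le k\le N$) and $\beta_{kl}$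 ($1\le k<l\le N$), say that a central extension has coefficients $(\alpha,\beta)$ if the generators $J_{ab},M_{ab},B_l$ can be lifted to elements of $\overline{\mathcal G}$, denoted by the same letters, which satisfy all the relations (R) and $$[J_{ab},M_{ab}]=-2\omega_{ab}\sum_{s=a+1}^bB_s+\sum_{s=a+1}^b\omega_{a\,s-1}\,\omega_{sb}\,\alpha_s\,\Xi\quad(a<b),\qquad [B_k,B_l]=\beta_{kl}\,\Xi\quad(k<l).$$ **Theorem.** 1. Every central extension of $su_\omega(N+1)$ has some coefficients $(\alpha,\beta)$, and any such coefficients satisfy $\omega_k\beta_{kl}=0$ and $\omega_l\beta_{kl}=0$ for all $k<l$. 2. Conversely, all real $\alpha_k$ and all real $\beta_{kl}$ with $\omega_k\beta_{kl}=\omega_l\beta_{kl}=0$ ($k<l$) are the coefficients of some central extension. 3. Two central extensions with the same coefficients $(\alpha,\beta)$ are equivalent. 4. A central extension with coefficients $(\alpha,\beta)$ is trivial if and only if $\alpha_k=0$ for every $k$ with $\omega_k=0$, and $\beta_{kl}=0$ for all $k<l$. In particular: - if $\alpha_k\ne0$ for a single $k$ and all other coefficients vanish, then the extension is non-trivial if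 and only if $\omega_k=0$; - if $\beta_{kl}\neq0$ for some $k<l$, then $\omega_k=\omega_l=0$ and the extension is non-trivial, whatever the other coefficients are. -/

import Mathlib

open scoped BigOperators Matrix

universe u v

noncomputable section

namespace CK

attribute [local instance] LieRing.ofAssociativeRing

/-- The indices `s` with `a + 1 ≤ s ≤ b`. Throughout, an index `s ∈ {1, …, N}` is an element
`s : Fin N`; viewed in `{0, …, N} = Fin (N + 1)`, the index `s` is `s.succ` and the index `s - 1` is
`s.castSucc`. -/
def between {N : ℕ} (a b : Fin (N + 1)) : Finset (Fin N) :=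
  Finset.univ.filter fun s => a ≤ s.castSucc ∧ s.succ ≤ b

/-- The two-index coefficient `ω_{ab} = ω_{a+1} ω_{a+2} ⋯ ω_b` for `a ≤ b` (so `ω_{aa} = 1`). -/
def omega {N : ℕ} (ω : Fin N → ℝ) (a b : Fin (N + 1)) : ℝ :=
  ∏ s ∈ between a b, ω s

/-- The coefficient `δ_{a,l-1} - δ_{b,l-1} + δ_{b,l} - δ_{a,l}`. -/
def rootCoeff {N : ℕ} (a b : Fin (N + 1)) (l : Fin N) : ℝ :=
  (if a = l.castSucc then 1 else 0) - (if b = l.castSucc then 1 else 0)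
    + (if b = l.succ then 1 else 0) - (if a = l.succ then 1 else 0)

/-- Complex square matrices with rows and columns labelled `0, …, N`. -/
abbrev Mat (N : ℕ) : Type := Matrix (Fin (N + 1)) (Fin (N + 1)) ℂ

/-- `J_{ab} = -ω_{ab} e_{ab} + e_{ba}` (used for `a < b`). -/
def matJ {N : ℕ} (ω : Fin N → ℝ) (a b : Fin (N + 1)) : Mat N :=
  Matrix.single a b (-(omega ω a b : ℂ)) + Matrix.single b a 1

/-- `M_{ab} = i (ω_{ab} e_{ab} + e_{ba})` (used for `a < b`). -/
def matM {N : ℕ} (ω : Fin N → ℝ) (a b : Fin (N + 1)) : Mat N :=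
  Matrix.single a b (Complex.I * (omega ω a b : ℂ)) + Matrix.single b a Complex.I

/-- `B_l = i (e_{l-1,l-1} - e_{l,l})`. -/
def matB {N : ℕ} (l : Fin N) : Mat N :=
  Matrix.single l.castSucc l.castSucc Complex.I - Matrix.single l.succ l.succ Complex.I

/-- The labels of the generators: one `J_{ab}` and one `M_{ab}` for each pair `a < b`, and one `B_l`
for each `l ∈ {1, …, N}`. -/
abbrev GenIndex (N : ℕ) : Type :=
  {p : Fin (N + 1) × Fin (N + 1) // p.1 < p.2} ⊕
    {p : Fin (N + 1) × Fin (N + 1) // p.1 < p.2} ⊕ Fin N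

/-- The family of all generators. -/
def gen {N : ℕ} (ω : Fin N → ℝ) : GenIndex N → Mat N :=
  Sum.elim (fun p => matJ ω p.1.1 p.1.2)
    (Sum.elim (fun p => matM ω p.1.1 p.1.2) (fun l => matB l))

/-- The commutation relations of the special unitary Cayley-Klein algebra with an additional element
`Ξ`: all brackets are those of `su_ω(N+1)` except that `[J_{ab}, M_{ab}]` is modified by terms with
coefficients `α_s` and `[B_k, B_l] = β_{kl} Ξ`. For `Ξ = 0` these are the commutation relations of
`su_ω(N+1)` itself. Only the values `J a b`, `M a b` with `a < b` and `β k l` with `k < l` matter. -/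
structure Relations {N : ℕ} {L : Type*} [LieRing L] [LieAlgebra ℝ L] (ω : Fin N → ℝ)
    (J M : Fin (N + 1) → Fin (N + 1) → L) (B : Fin N → L) (Ξ : L)
    (α : Fin N → ℝ) (β : Fin N → Fin N → ℝ) : Prop where
  JJ_ab_ac : ∀ a b c, a < b → b < c → ⁅J a b, J a c⁆ = omega ω a b • J b c
  JJ_ab_bc : ∀ a b c, a < b → b < c → ⁅J a b, J b c⁆ = -J a c
  JJ_ac_bc : ∀ a b c, a < b → b < c → ⁅J a c, J b c⁆ = omega ω b c • J a b
  MM_ab_ac : ∀ a b c, a < b → b < c → ⁅M a b, M a c⁆ = omega ω a b • J b c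
  MM_ab_bc : ∀ a b c, a < b → b < c → ⁅M a b, M b c⁆ = J a c
  MM_ac_bc : ∀ a b c, a < b → b < c → ⁅M a c, M b c⁆ = omega ω b c • J a b
  JM_ab_ac : ∀ a b c, a < b → b < c → ⁅J a b, M a c⁆ = omega ω a b • M b c
  JM_ab_bc : ∀ a b c, a < b → b < c → ⁅J a b, M b c⁆ = -M a c
  JM_ac_bc : ∀ a b c, a < b → b < c → ⁅J a c, M b c⁆ = -(omega ω b c • M a b)
  MJ_ab_ac : ∀ a b c, a < b → b < c → ⁅M a b, J a c⁆ = -(omega ω a b • M b c)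
  MJ_ab_bc : ∀ a b c, a < b → b < c → ⁅M a b, J b c⁆ = -M a c
  MJ_ac_bc : ∀ a b c, a < b → b < c → ⁅M a c, J b c⁆ = omega ω b c • M a b
  JJ_ab_de : ∀ a b d e, a < b → d < e → a ≠ d → a ≠ e → b ≠ d → b ≠ e → ⁅J a b, J d e⁆ = 0
  MM_ab_de : ∀ a b d e, a < b → d < e → a ≠ d → a ≠ e → b ≠ d → b ≠ e → ⁅M a b, M d e⁆ = 0
  JM_ab_de : ∀ a b d e, a < b → d < e → a ≠ d → a ≠ e → b ≠ d → b ≠ e → ⁅J a b, M d e⁆ = 0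
  JB : ∀ a b l, a < b → ⁅J a b, B l⁆ = rootCoeff a b l • M a b
  MB : ∀ a b l, a < b → ⁅M a b, B l⁆ = -(rootCoeff a b l • J a b)
  JM : ∀ a b, a < b → ⁅J a b, M a b⁆ = -((2 * omega ω a b) • ∑ s ∈ between a b, B s)
    + (∑ s ∈ between a b, omega ω a s.castSucc * omega ω s.succ b * α s) • Ξ
  BB : ∀ k l, k < l → ⁅B k, B l⁆ = β k l • Ξ

lemma mem_between {N : ℕ} {a b : Fin (N + 1)} {s : Fin N} :
    s ∈ between a b ↔ a ≤ s.castSucc ∧ s.succ ≤ b := by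
  simp [between]

lemma omega_self {N : ℕ} (ω : Fin N → ℝ) (a : Fin (N + 1)) : omega ω a a = 1 := by
  refine Finset.prod_eq_one fun s hs => ?_
  rw [mem_between] at hs
  have h := hs.1.trans_lt (Fin.castSucc_lt_succ (i := s))
  exact absurd hs.2 (not_le.2 h)

lemma omega_mul {N : ℕ} (ω : Fin N → ℝ) {a b c : Fin (N + 1)} (hab : a ≤ b) (hbc : b ≤ c) :
    omega ω a b * omega ω b c = omega ω a c := by
  unfold omega
  rw [← Finset.prod_union]
  · congr 1
    ext s
    simp only [Finset.mem_union, mem_between, Fin.le_def, Fin.val_castSucc, Fin.val_succ] at *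
    omega
  · rw [Finset.disjoint_left]
    intro s h1 h2
    simp only [mem_between, Fin.le_def, Fin.val_castSucc, Fin.val_succ] at *
    omega

/-- Entrywise description of the real span of the generators. -/
def Good {N : ℕ} (ω : Fin N → ℝ) (X : Mat N) : Prop :=
  (∀ a b, a ≤ b → X a b = -(omega ω a b : ℂ) * star (X b a)) ∧ X.trace = 0

lemma good_lie {N : ℕ} (ω : Fin N → ℝ) {X Y : Mat N} (hX : Good ω X) (hY : Good ω Y) :
    Good ω ⁅X, Y⁆ := by
  have key : ∀ {X Y : Mat N}, Good ω X → Good ω Y → ∀ a b, a ≤ b →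
      (X * Y) a b = (omega ω a b : ℂ) * star ((Y * X) b a) := by
    intro X Y hX hY a b hab
    rw [Matrix.mul_apply, Matrix.mul_apply, star_sum, Finset.mul_sum]
    refine Finset.sum_congr rfl fun c _ => ?_
    rcases le_total a c with hac | hca
    · rcases le_total c b with hcb | hbc
      · rw [hX.1 a c hac, hY.1 c b hcb, ← omega_mul ω hac hcb]
        simp only [star_mul']
        push_cast
        ring
      · rw [hX.1 a c hac, hY.1 b c hbc, ← omega_mul ω hab hbc]
        simp only [star_mul', star_neg, Complex.star_def, Complex.conj_ofReal, Complex.conj_conj]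
        push_cast
        ring
    · rw [hX.1 c a hca, hY.1 c b (hca.trans hab), ← omega_mul ω hca hab]
      simp only [star_mul', star_neg, Complex.star_def, Complex.conj_ofReal, Complex.conj_conj]
      push_cast
      ring
  refine ⟨fun a b hab => ?_, ?_⟩
  · rw [Ring.lie_def, Matrix.sub_apply, Matrix.sub_apply, key hX hY a b hab, key hY hX a b hab,
      star_sub]
    ring
  · rw [Ring.lie_def, Matrix.trace_sub, Matrix.trace_mul_comm, sub_self]

lemma good_gen {N : ℕ} (ω : Fin N → ℝ) (i : GenIndex N) : Good ω (gen ω i) := by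
  rcases i with ⟨⟨x, y⟩, hxy⟩ | ⟨⟨x, y⟩, hxy⟩ | l
  · have hxy' : x < y := hxy
    refine ⟨fun a b hab => ?_, ?_⟩
    · simp only [gen, Sum.elim_inl, matJ, Matrix.add_apply, Matrix.single_apply]
      by_cases h1 : x = a <;> by_cases h2 : y = b <;> by_cases h3 : y = a <;> by_cases h4 : x = b <;>
        simp_all <;> grind
    · simp [gen, matJ, Matrix.trace_single_eq_of_ne, hxy'.ne, hxy'.ne']
  · have hxy' : x < y := hxy
    refine ⟨fun a b hab => ?_, ?_⟩
    · simp only [gen, Sum.elim_inl, Sum.elim_inr, matM, Matrix.add_apply, Matrix.single_apply]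
      by_cases h1 : x = a <;> by_cases h2 : y = b <;> by_cases h3 : y = a <;> by_cases h4 : x = b <;>
        simp_all <;> grind
    · simp [gen, matM, Matrix.trace_single_eq_of_ne, hxy'.ne, hxy'.ne']
  · refine ⟨fun a b hab => ?_, ?_⟩
    · simp only [gen, Sum.elim_inr, matB, Matrix.sub_apply, Matrix.single_apply]
      by_cases h : a = b
      · subst h
        rw [omega_self]
        simp only [and_self]
        split_ifs <;> simp
      · have e1 : ∀ x : Fin (N + 1), ¬(x = a ∧ x = b) := fun x hx => h (hx.1.symm.trans hx.2)
        have e2 : ∀ x : Fin (N + 1), ¬(x = b ∧ x = a) := fun x hx => h (hx.2.symm.trans hx.1)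
        simp [e1, e2]
    · simp [gen, matB]

lemma diag_mem {N : ℕ} (ω : Fin N → ℝ) (c : Fin (N + 1)) :
    (Matrix.single c c Complex.I - Matrix.single 0 0 Complex.I : Mat N)
      ∈ Submodule.span ℝ (Set.range (gen ω)) := by
  induction c using Fin.induction with
  | zero => simp
  | succ l ih =>
    have h : (matB l : Mat N) ∈ Submodule.span ℝ (Set.range (gen ω)) :=
      Submodule.subset_span ⟨Sum.inr (Sum.inr l), rfl⟩
    have h2 := Submodule.sub_mem _ ih h
    convert h2 using 1
    simp only [matB]
    abel

lemma mem_span_iff {N : ℕ} (ω : Fin N → ℝ) (X : Mat N) :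
    X ∈ Submodule.span ℝ (Set.range (gen ω)) ↔ Good ω X := by
  constructor
  · intro h
    induction h using Submodule.span_induction with
    | mem x hx => obtain ⟨i, rfl⟩ := hx; exact good_gen ω i
    | zero => exact ⟨fun a b _ => by simp, by simp⟩
    | add x y _ _ hx hy =>
      refine ⟨fun a b hab => ?_, by rw [Matrix.trace_add, hx.2, hy.2, add_zero]⟩
      rw [Matrix.add_apply, Matrix.add_apply, hx.1 a b hab, hy.1 a b hab, star_add]
      ring
    | smul r x _ hx =>
      refine ⟨fun a b hab => ?_, by rw [Matrix.trace_smul, hx.2, smul_zero]⟩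
      rw [Matrix.smul_apply, Matrix.smul_apply, hx.1 a b hab, star_smul]
      simp
      ring
  · intro h
    have hdiag : ∀ c, X c c = ((X c c).im : ℂ) * Complex.I := fun c => by
      have h1 := h.1 c c le_rfl
      rw [omega_self] at h1
      have h2 := congrArg Complex.re h1
      simp at h2
      apply Complex.ext
      · simp
        linarith
      · simp
    have htr : ∑ c, (X c c).im = 0 := by
      have h1 := congrArg Complex.im h.2
      simpa [Matrix.trace] using h1
    have hpair : ∀ a b, a < b → (X b a).re • matJ ω a b + (X b a).im • matM ω a b
        = Matrix.single a b (X a b) + Matrix.single b a (X b a) := fun a b hab => by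
      have e1 : X a b = ((X b a).re : ℂ) * -(omega ω a b : ℂ)
          + ((X b a).im : ℂ) * (Complex.I * (omega ω a b : ℂ)) := by
        rw [h.1 a b hab.le]
        apply Complex.ext <;> simp <;> ring
      have e2 : X b a = ((X b a).re : ℂ) * 1 + ((X b a).im : ℂ) * Complex.I := by
        apply Complex.ext <;> simp
      rw [matJ, matM, smul_add, smul_add]
      simp only [Matrix.smul_single, Complex.real_smul]
      rw [add_add_add_comm, ← Matrix.single_add, ← Matrix.single_add, ← e1, ← e2]
    have hdecomp : X = (∑ a, ∑ b, if a < b then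
          ((X b a).re • matJ ω a b + (X b a).im • matM ω a b) else 0)
        + ∑ c, (X c c).im •
          (Matrix.single c c Complex.I - Matrix.single 0 0 Complex.I : Mat N) := by
      simp only [smul_sub, Finset.sum_sub_distrib, ← Finset.sum_smul, htr, zero_smul, sub_zero]
      simp only [Matrix.smul_single, Complex.real_smul, ← hdiag]
      have e3 : ∀ a b : Fin (N + 1), (if a < b then
          ((X b a).re • matJ ω a b + (X b a).im • matM ω a b) else 0) = if a < b then
          (Matrix.single a b (X a b) + Matrix.single b a (X b a)) else 0 := fun a b => by
        split_ifs with hab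
        · exact hpair a b hab
        · rfl
      simp only [e3]
      ext i j
      have e4 : ∀ a b : Fin (N + 1), (if a < b then
          (Matrix.single a b (X a b) + Matrix.single b a (X b a)) else (0 : Mat N)) i j =
          (if a = i then if b = j then (if i < j then X i j else 0) else 0 else 0)
          + (if b = i then if a = j then (if j < i then X i j else 0) else 0 else 0) := by
        intro a b
        clear e3 hpair hdiag h htr
        by_cases hab : a < b
        · rw [if_pos hab, Matrix.add_apply, Matrix.single_apply, Matrix.single_apply]
          grind
        · rw [if_neg hab, Matrix.zero_apply]
          grind
      have e5 : ∀ c : Fin (N + 1), Matrix.single c c (X c c) i j =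
          if c = i then (if i = j then X i j else 0) else 0 := by
        intro c
        clear e4 e3 hpair hdiag h htr
        rw [Matrix.single_apply]
        grind
      simp only [Matrix.add_apply, Matrix.sum_apply, e4, e5, Finset.sum_add_distrib]
      rcases lt_trichotomy i j with hij | hij | hij
      · simp [hij, hij.ne, hij.not_gt]
      · subst hij
        simp
      · simp [hij, hij.ne', hij.not_gt]
    rw [hdecomp]
    refine Submodule.add_mem _ (Submodule.sum_mem _ fun a _ => Submodule.sum_mem _ fun b _ => ?_)
      (Submodule.sum_mem _ fun c _ => Submodule.smul_mem _ _ (diag_mem ω c))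
    split_ifs with hab
    · exact Submodule.add_mem _
        (Submodule.smul_mem _ _ (Submodule.subset_span ⟨Sum.inl ⟨(a, b), hab⟩, rfl⟩))
        (Submodule.smul_mem _ _ (Submodule.subset_span ⟨Sum.inr (Sum.inl ⟨(a, b), hab⟩), rfl⟩))
    · exact Submodule.zero_mem _

/-- The special unitary Cayley-Klein algebra `su_ω(N+1)`: the real Lie algebra of complex matrices
spanned by all `J_{ab}`, `M_{ab}` (`a < b`) and `B_l`. -/
def su {N : ℕ} (ω : Fin N → ℝ) : LieSubalgebra ℝ (Mat N) where
  __ := Submodule.span ℝ (Set.range (gen ω))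
  lie_mem' {x y} hx hy := by
    have hx' : x ∈ Submodule.span ℝ (Set.range (gen ω)) := hx
    have hy' : y ∈ Submodule.span ℝ (Set.range (gen ω)) := hy
    rw [mem_span_iff] at hx' hy'
    exact (mem_span_iff ω _).2 (good_lie ω hx' hy')

/-- The generators are linearly independent over `ℝ`, so they form a basis of `su_ω(N+1)`. -/
theorem linearIndependent_gen {N : ℕ} (ω : Fin N → ℝ) : LinearIndependent ℝ (gen ω) := by
  rw [Fintype.linearIndependent_iff]
  intro g hg
  have hentry : ∀ i j, ∑ k, (g k : ℂ) * gen ω k i j = 0 := fun i j => by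
    have h := congrFun (congrFun hg i) j
    simpa [Matrix.sum_apply] using h
  have hlow : ∀ a b (hab : a < b), (g (Sum.inl ⟨(a, b), hab⟩) : ℂ)
      + (g (Sum.inr (Sum.inl ⟨(a, b), hab⟩)) : ℂ) * Complex.I = 0 := fun a b hab => by
    have h := hentry b a
    rw [Fintype.sum_sum_type, Fintype.sum_sum_type,
      Finset.sum_eq_single ⟨(a, b), hab⟩, Finset.sum_eq_single ⟨(a, b), hab⟩,
      Finset.sum_eq_zero (s := Finset.univ) (f := fun l : Fin N => _)] at h
    · simpa [gen, matJ, matM, Matrix.single_apply, hab.ne, hab.ne'] using h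
    · intro l _
      have e1 : ∀ x : Fin (N + 1), ¬(x = b ∧ x = a) := fun x hx =>
        hab.ne (hx.2.symm.trans hx.1)
      simp [gen, matB, e1]
    · rintro ⟨⟨c, d⟩, hcd⟩ _ hne
      have hcd' : c < d := hcd
      have e1 : ¬(c = b ∧ d = a) := fun hx => by
        rw [hx.1, hx.2] at hcd'
        exact hab.not_gt hcd'
      have e2 : ¬(d = b ∧ c = a) := fun hx => hne (by simp [hx.1, hx.2])
      simp [gen, matM, e1, e2]
    · simp
    · rintro ⟨⟨c, d⟩, hcd⟩ _ hne
      have hcd' : c < d := hcd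
      have e1 : ¬(c = b ∧ d = a) := fun hx => by
        rw [hx.1, hx.2] at hcd'
        exact hab.not_gt hcd'
      have e2 : ¬(d = b ∧ c = a) := fun hx => hne (by simp [hx.1, hx.2])
      simp [gen, matJ, e1, e2]
    · simp
  have hJ : ∀ p, g (Sum.inl p) = 0 := fun p => by
    simpa using congrArg Complex.re (hlow p.1.1 p.1.2 p.2)
  have hM : ∀ p, g (Sum.inr (Sum.inl p)) = 0 := fun p => by
    simpa using congrArg Complex.im (hlow p.1.1 p.1.2 p.2)
  have hdiag : ∀ c : Fin (N + 1), ∑ l : Fin N, g (Sum.inr (Sum.inr l)) *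
      ((if l.castSucc = c then 1 else 0) - (if l.succ = c then 1 else 0)) = 0 := fun c => by
    have h := congrArg Complex.im (hentry c c)
    simp only [Fintype.sum_sum_type, hJ, hM, Complex.ofReal_zero, zero_mul, Finset.sum_const_zero,
      zero_add, Complex.im_sum, Complex.zero_im] at h
    refine Eq.trans (Finset.sum_congr rfl fun l _ => ?_) h
    simp only [gen, matB, Sum.elim_inr, Matrix.sub_apply, Matrix.single_apply, and_self]
    split_ifs <;> simp
  have hB : ∀ l : Fin N, g (Sum.inr (Sum.inr l)) = 0 := by
    intro l
    have h : ∑ c ∈ Finset.univ.filter (fun c : Fin (N + 1) => c ≤ l.castSucc),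
        ∑ k : Fin N, g (Sum.inr (Sum.inr k)) *
          ((if k.castSucc = c then 1 else 0) - (if k.succ = c then 1 else 0)) = 0 :=
      Finset.sum_eq_zero fun c _ => hdiag c
    rw [Finset.sum_comm, Finset.sum_eq_single l] at h
    · simpa [← Finset.mul_sum, Finset.sum_sub_distrib, Finset.sum_ite_eq] using h
    · intro k _ hk
      rw [← Finset.mul_sum]
      have hiff : k.castSucc ≤ l.castSucc ↔ k.succ ≤ l.castSucc := by
        simp only [Fin.le_def, Fin.val_castSucc, Fin.val_succ]
        have : (k : ℕ) ≠ l := fun hh => hk (Fin.ext hh)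
        omega
      simp [Finset.sum_sub_distrib, Finset.sum_ite_eq, hiff]
    · simp
  rintro (p | p | l)
  exacts [hJ p, hM p, hB l]

lemma sum_matB {N : ℕ} {a b : Fin (N + 1)} (hab : a ≤ b) : ∑ s ∈ between a b, matB s =
    (Matrix.single a a Complex.I - Matrix.single b b Complex.I : Mat N) := by
  induction b using Fin.induction with
  | zero =>
    obtain rfl : a = 0 := le_antisymm hab (Fin.zero_le a)
    rw [sub_self]
    refine Finset.sum_eq_zero fun s hs => ?_
    exact absurd (mem_between.1 hs).2 (not_le.2 (Fin.succ_pos s))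
  | succ l ih =>
    rcases hab.eq_or_lt with rfl | hlt
    · rw [sub_self]
      refine Finset.sum_eq_zero fun s hs => ?_
      have h := mem_between.1 hs
      exact absurd h.2 (not_le.2 (h.1.trans_lt Fin.castSucc_lt_succ))
    · have hal : a ≤ l.castSucc := Fin.le_castSucc_iff.2 hlt
      have hins : between a l.succ = insert l (between a l.castSucc) := by
        ext s
        simp only [Finset.mem_insert, mem_between, Fin.le_def, Fin.val_castSucc, Fin.val_succ,
          Fin.ext_iff] at *
        omega
      rw [hins, Finset.sum_insert, ih hal, matB]
      · abel
      · simp [mem_between, Fin.le_def]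

/-- The generators of `su_ω(N+1)` satisfy the commutation relations without central terms. -/
theorem relations_su {N : ℕ} (ω : Fin N → ℝ) :
    Relations ω (matJ ω) (matM ω) (matB (N := N)) 0 0 0 := by
  have hI : Complex.I * Complex.I = -1 := Complex.I_mul_I
  have hw : ∀ a b c : Fin (N + 1), a < b → b < c →
      (omega ω a c : ℂ) = (omega ω a b : ℂ) * (omega ω b c : ℂ) := fun a b c hab hbc => by
    rw [← omega_mul ω hab.le hbc.le]
    push_cast
    rfl
  have hlin : ∀ (a b : Fin (N + 1)) (x : ℂ), (Matrix.single a b x : Mat N) =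
      x • Matrix.single a b 1 := fun a b x => by simp [Matrix.smul_single]
  have hre : ∀ (r : ℝ) (X : Mat N), r • X = (r : ℂ) • X := fun r X => by ext i j; simp
  have hB : ∀ l : Fin N, matB l = (Matrix.diagonal fun x : Fin (N + 1) =>
      Complex.I * ((if x = l.castSucc then 1 else 0) - (if x = l.succ then 1 else 0)) : Mat N) := by
    intro l
    ext i j
    simp only [matB, Matrix.sub_apply, Matrix.single_apply, Matrix.diagonal_apply]
    clear hlin hre hw hI
    grind
  have hsd : ∀ (a b : Fin (N + 1)) (x : ℂ) (d : Fin (N + 1) → ℂ),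
      (Matrix.single a b x : Mat N) * Matrix.diagonal d = Matrix.single a b (x * d b) := by
    intro a b x d
    ext i j
    rw [Matrix.mul_diagonal, Matrix.single_apply, Matrix.single_apply]
    split_ifs with h
    · rw [h.2]
    · simp
  have hds : ∀ (a b : Fin (N + 1)) (x : ℂ) (d : Fin (N + 1) → ℂ),
      Matrix.diagonal d * (Matrix.single a b x : Mat N) = Matrix.single a b (d a * x) := by
    intro a b x d
    ext i j
    rw [Matrix.diagonal_mul, Matrix.single_apply, Matrix.single_apply]
    split_ifs with h
    · rw [h.1]
    · simp
  have hite : ∀ (p : Prop) [Decidable p], (((if p then 1 else 0 : ℝ)) : ℂ) =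
      if p then 1 else 0 := fun p _ => by split_ifs <;> simp
  have hsub : ∀ (a b : Fin (N + 1)) (x y : ℂ), (Matrix.single a b x - Matrix.single a b y : Mat N)
      = Matrix.single a b (x - y) := by
    intro a b x y
    rw [hlin a b x, hlin a b y, hlin a b (x - y), sub_smul]
  constructor
  case JM =>
    intro a b hab
    rw [sum_matB hab.le]
    simp only [Ring.lie_def, matJ, matM, add_mul, mul_add, Matrix.single_mul_single_same,
      Matrix.single_mul_single_of_ne _ _ _ _ hab.ne, Matrix.single_mul_single_of_ne _ _ _ _ hab.ne',
      hre, smul_zero, add_zero, zero_add]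
    rw [hlin a a (_ * _), hlin b b (_ * _), hlin a a Complex.I, hlin b b Complex.I,
      hlin a a (_ * _), hlin b b (_ * _)]
    push_cast
    module
  case BB =>
    intro k l _
    rw [hB, hB, Ring.lie_def, Matrix.diagonal_mul_diagonal, Matrix.diagonal_mul_diagonal,
      smul_zero, sub_eq_zero]
    congr 1
    funext x
    ring
  case JB =>
    intro a b l _
    simp only [hB, Ring.lie_def, matJ, matM, add_mul, mul_add, hsd, hds, hre]
    rw [add_sub_add_comm, hsub, hsub, smul_add]
    simp only [Matrix.smul_single, smul_eq_mul]
    congr 2 <;> simp only [rootCoeff] <;> push_cast [hite] <;> ring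
  case MB =>
    intro a b l _
    simp only [hB, Ring.lie_def, matJ, matM, add_mul, mul_add, hsd, hds, hre]
    rw [add_sub_add_comm, hsub, hsub, smul_add, neg_add]
    simp only [Matrix.smul_single, smul_eq_mul, Matrix.single_neg]
    congr 2 <;> simp only [rootCoeff] <;> push_cast [hite] <;> ring_nf <;> simp only [Complex.I_sq] <;> ring
  case JJ_ab_de =>
    intro a b d e hab hde h1 h2 h3 h4
    simp only [Ring.lie_def, matJ, add_mul, mul_add, ne_eq, not_false_eq_true, h1, h2, h3, h4,
      h1.symm, h2.symm, h3.symm, h4.symm, Matrix.single_mul_single_of_ne, add_zero, sub_zero]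
  case MM_ab_de =>
    intro a b d e hab hde h1 h2 h3 h4
    simp only [Ring.lie_def, matM, add_mul, mul_add, ne_eq, not_false_eq_true, h1, h2, h3, h4,
      h1.symm, h2.symm, h3.symm, h4.symm, Matrix.single_mul_single_of_ne, add_zero, sub_zero]
  case JM_ab_de =>
    intro a b d e hab hde h1 h2 h3 h4
    simp only [Ring.lie_def, matJ, matM, add_mul, mul_add, ne_eq, not_false_eq_true, h1, h2, h3, h4,
      h1.symm, h2.symm, h3.symm, h4.symm, Matrix.single_mul_single_of_ne, add_zero, sub_zero]
  all_goals
    intro a b c hab hbc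
    have hac := hab.trans hbc
    simp only [Ring.lie_def, matJ, matM, add_mul, mul_add, ne_eq, not_false_eq_true, hab.ne, hab.ne',
      hbc.ne, hbc.ne', hac.ne, hac.ne', Matrix.single_mul_single_same,
      Matrix.single_mul_single_of_ne, add_zero, zero_add, hre, smul_add,
      Matrix.smul_single, smul_eq_mul, hw a b c hab hbc, neg_add]
    clear hlin hre hw
    ext i j
    simp only [Matrix.add_apply, Matrix.sub_apply, Matrix.neg_apply, Matrix.single_apply]
    grind

/-- Extensions of `su_ω(N+1)` by the one-dimensional Lie algebra `ℝ`, that is, short exact sequences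
`0 → ℝ → L → su_ω(N+1) → 0` of real Lie algebras. The additional generator is `Ξ = E.incl 1`. -/
abbrev Ext {N : ℕ} (ω : Fin N → ℝ) : Type (u + 1) := LieAlgebra.Extension.{0, 0, 0, u} ℝ ℝ (su ω)

/-- The extension is central. -/
def IsCentral {N : ℕ} {ω : Fin N → ℝ} (E : Ext.{u} ω) : Prop :=
  ∀ (t : ℝ) (x : E.L), ⁅E.incl t, x⁆ = 0

/-- The extension is trivial: it splits, that is, the generators can be lifted so that no central
term is left in the brackets (equivalently, its two-cocycle is a coboundary). -/
def IsTrivial {N : ℕ} {ω : Fin N → ℝ} (E : Ext.{u} ω) : Prop :=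
  ∃ s : su ω →ₗ⁅ℝ⁆ E.L, ∀ x, E.proj (s x) = x

/-- Equivalence of extensions: an isomorphism of the extended algebras which is compatible with the
projections to `su_ω(N+1)` and fixes the central generator. -/
def Equivalent {N : ℕ} {ω : Fin N → ℝ} (E : Ext.{u} ω) (F : Ext.{v} ω) : Prop :=
  ∃ f : E.L ≃ₗ⁅ℝ⁆ F.L, (∀ x, F.proj (f x) = E.proj x) ∧ ∀ t, f (E.incl t) = F.incl t

/-- The extension `E` has coefficients `α`, `β`: the generators of `su_ω(N+1)` can be lifted to
elements of the extended algebra which satisfy the relations with these central terms. -/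
def HasCoeffs {N : ℕ} {ω : Fin N → ℝ} (E : Ext.{u} ω) (α : Fin N → ℝ) (β : Fin N → Fin N → ℝ) : Prop :=
  ∃ (J M : Fin (N + 1) → Fin (N + 1) → E.L) (B : Fin N → E.L),
    (∀ a b, a < b → (E.proj (J a b) : Mat N) = matJ ω a b) ∧
    (∀ a b, a < b → (E.proj (M a b) : Mat N) = matM ω a b) ∧
    (∀ l, (E.proj (B l) : Mat N) = matB l) ∧
    Relations ω J M B (E.incl 1) α β

/-- The conditions `ω_k β_{kl} = 0` and `ω_l β_{kl} = 0` for `k < l`. -/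
def Admissible {N : ℕ} (ω : Fin N → ℝ) (β : Fin N → Fin N → ℝ) : Prop :=
  ∀ k l, k < l → ω k * β k l = 0 ∧ ω l * β k l = 0

end CK

end

noncomputable section

namespace CK

attribute [local instance] LieRing.ofAssociativeRing

/-! A linear section of a central extension has a real two-cocycle on `su ω`, and moving the section
by multiples of $\Xi$ changes it by a coboundary. The theorem thus amounts to a normal form for
two-cocycles modulo coboundaries.

Existence rests on the forms $P_k$ (`pairing`), which satisfy $b_k([X,Y])=-2\omega_kP_k(X,Y)$, where
$b_k$ (`diagCoord`) is the coordinate along $B_k$ (`diagCoord_lie`). If $\omega_k\ne0$, then $P_k$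
is a coboundary. If $\omega_k=0$, it is still a cocycle: $P_k$ does not involve $\omega_k$, and its
cyclic identity can be checked after replacing $\omega_k$ by $1$ (`pairing_jacobi`). The same
formula shows that $\beta_{kl}\,b_k\wedge b_l$ vanishes on commutators when
$\omega_k\beta_{kl}=\omega_l\beta_{kl}=0$. So $\sum\alpha_kP_k+\sum\beta_{kl}\,b_k\wedge b_l$
(`stdForm`) is a cocycle.

Completeness uses a diagonal element $H$ with generic roots. A coboundary removes all values between
off-diagonal generators and the $B_l$ (`IsCocycle.exists_normalized`); the Jacobi identity with $H$
then makes different root spaces orthogonal (`Normalized.root_root`). A recursion on the length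
$b-a$ reduces the values on $(J_{ab},M_{ab})$ to those on neighbouring indices
(`IsCocycle.suJ_suM_eq_zero`). What remains are the numbers $\alpha_k$, $\beta_{kl}$, so the cocycle
is the standard one (`Normalized.eq_stdForm`).

Triviality is decided on commuting pairs, where every coboundary vanishes: $(B_k,B_l)$ always, and
$(J_{k-1,k},M_{k-1,k})$ when $\omega_k=0$. -/

lemma lie_lie_add_cyclic {L : Type*} [LieRing L] (x y z : L) :
    ⁅⁅x, y⁆, z⁆ + ⁅⁅y, z⁆, x⁆ + ⁅⁅z, x⁆, y⁆ = 0 := by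
  rw [← lie_skew ⁅x, y⁆ z, ← lie_skew ⁅y, z⁆ x, ← lie_skew ⁅z, x⁆ y, ← neg_add, ← neg_add,
    neg_eq_zero, ← lie_jacobi x y z]
  abel

/-! ### Coordinates along the diagonal generators -/

/-- The sum of the imaginary parts of the first `k` diagonal entries. On `su ω` this is the
coordinate along `B_k`. -/
def diagCoord {N : ℕ} (k : Fin N) : Mat N →ₗ[ℝ] ℝ where
  toFun X := ∑ c, if c ≤ k.castSucc then (X c c).im else 0
  map_add' X Y := by
    rw [← Finset.sum_add_distrib]
    refine Finset.sum_congr rfl fun c _ => ?_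
    split_ifs <;> simp
  map_smul' r X := by
    simp [Finset.mul_sum, mul_ite]

lemma diagCoord_apply {N : ℕ} (k : Fin N) (X : Mat N) :
    diagCoord k X = ∑ c, if c ≤ k.castSucc then (X c c).im else 0 := rfl

lemma diagCoord_eq_zero {N : ℕ} (k : Fin N) {X : Mat N} (h : ∀ c, X c c = 0) :
    diagCoord k X = 0 := by
  simp [diagCoord_apply, h]

lemma matJ_diag {N : ℕ} (ω : Fin N → ℝ) {a b : Fin (N + 1)} (hab : a < b) (c : Fin (N + 1)) :
    matJ ω a b c c = 0 := by
  simp only [matJ, Matrix.add_apply, Matrix.single_apply]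
  grind

lemma matM_diag {N : ℕ} (ω : Fin N → ℝ) {a b : Fin (N + 1)} (hab : a < b) (c : Fin (N + 1)) :
    matM ω a b c c = 0 := by
  simp only [matM, Matrix.add_apply, Matrix.single_apply]
  grind

lemma matB_of_ne {N : ℕ} (l : Fin N) {c d : Fin (N + 1)} (h : c ≠ d) :
    (matB l : Mat N) c d = 0 := by
  simp only [matB, Matrix.sub_apply, Matrix.single_apply]
  grind

lemma matB_diag {N : ℕ} (l : Fin N) (c : Fin (N + 1)) :
    (matB l : Mat N) c c =
      Complex.I * ((if c = l.castSucc then 1 else 0) - (if c = l.succ then 1 else 0)) := by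
  simp only [matB, Matrix.sub_apply, Matrix.single_apply]
  grind

lemma diagCoord_matB {N : ℕ} (k l : Fin N) :
    diagCoord k (matB l : Mat N) = if k = l then 1 else 0 := by
  have h1 : ∀ c : Fin (N + 1), (if c ≤ k.castSucc then ((matB l : Mat N) c c).im else 0) =
      (if l.castSucc = c then (if l.castSucc ≤ k.castSucc then 1 else 0) else 0)
        - (if l.succ = c then (if l.succ ≤ k.castSucc then 1 else 0) else 0) := by
    intro c
    have e : ((matB l : Mat N) c c).im =
        (if c = l.castSucc then 1 else 0) - (if c = l.succ then 1 else 0) := by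
      rw [matB_diag]
      split_ifs <;> simp
    rw [e]
    grind
  rw [diagCoord_apply, Finset.sum_congr rfl fun c _ => h1 c, Finset.sum_sub_distrib,
    Finset.sum_ite_eq, Finset.sum_ite_eq]
  simp only [Finset.mem_univ, if_true, Fin.le_def, Fin.val_castSucc, Fin.val_succ, Fin.ext_iff]
  split_ifs <;> first | omega | norm_num

/-! ### The pairing across a cut and its relation to commutators -/

/-- The coefficient `ω_{c,k-1} ω_{kd}` if `c < k ≤ d`, and zero otherwise. -/
def cutCoeff {N : ℕ} (ω : Fin N → ℝ) (k : Fin N) (c d : Fin (N + 1)) : ℝ :=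
  if c ≤ k.castSucc ∧ k.succ ≤ d then omega ω c k.castSucc * omega ω k.succ d else 0

lemma cutCoeff_of_not_lt {N : ℕ} (ω : Fin N → ℝ) (k : Fin N) {c d : Fin (N + 1)} (h : ¬ c < d) :
    cutCoeff ω k c d = 0 :=
  if_neg fun hk => h ((hk.1.trans_lt Fin.castSucc_lt_succ).trans_le hk.2)

lemma between_step {N : ℕ} (k : Fin N) : between k.castSucc k.succ = {k} := by
  ext s
  simp only [mem_between, Finset.mem_singleton, Fin.le_def, Fin.val_castSucc, Fin.val_succ,
    Fin.ext_iff]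
  omega

lemma omega_step {N : ℕ} (ω : Fin N → ℝ) (k : Fin N) : omega ω k.castSucc k.succ = ω k := by
  rw [omega, between_step, Finset.prod_singleton]

/-- Across the cut, `cutCoeff` is $\omega_{cd}$ with the factor $\omega_k$ left out rather than
divided out, so it retains information when $\omega_k=0$. -/
lemma omega_eq_mul_cutCoeff {N : ℕ} (ω : Fin N → ℝ) {k : Fin N} {c d : Fin (N + 1)}
    (hc : c ≤ k.castSucc) (hd : k.succ ≤ d) : omega ω c d = ω k * cutCoeff ω k c d := by
  rw [cutCoeff, if_pos ⟨hc, hd⟩, ← omega_mul ω (hc.trans Fin.castSucc_lt_succ.le) hd,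
    ← omega_mul ω hc Fin.castSucc_lt_succ.le, omega_step]
  ring

/-- The bilinear form `∑_{c < k ≤ d} ω_{c,k-1} ω_{kd} Im (conj X_{dc} * Y_{dc})`. -/
def pairing {N : ℕ} (ω : Fin N → ℝ) (k : Fin N) : Mat N →ₗ[ℝ] Mat N →ₗ[ℝ] ℝ :=
  LinearMap.mk₂ ℝ (fun X Y => ∑ c, ∑ d, cutCoeff ω k c d *
      ((X d c).re * (Y d c).im - (X d c).im * (Y d c).re))
    (fun X X' Y => by
      simp only [← Finset.sum_add_distrib, Matrix.add_apply, Complex.add_re, Complex.add_im]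
      refine Finset.sum_congr rfl fun c _ => Finset.sum_congr rfl fun d _ => ?_
      ring)
    (fun r X Y => by
      simp only [smul_eq_mul, Finset.mul_sum, Matrix.smul_apply, Complex.real_smul, Complex.re_ofReal_mul,
        Complex.im_ofReal_mul]
      refine Finset.sum_congr rfl fun c _ => Finset.sum_congr rfl fun d _ => ?_
      ring)
    (fun X Y Y' => by
      simp only [← Finset.sum_add_distrib, Matrix.add_apply, Complex.add_re, Complex.add_im]
      refine Finset.sum_congr rfl fun c _ => Finset.sum_congr rfl fun d _ => ?_
      ring)
    (fun r X Y => by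
      simp only [smul_eq_mul, Finset.mul_sum, Matrix.smul_apply, Complex.real_smul, Complex.re_ofReal_mul,
        Complex.im_ofReal_mul]
      refine Finset.sum_congr rfl fun c _ => Finset.sum_congr rfl fun d _ => ?_
      ring)

lemma pairing_apply {N : ℕ} (ω : Fin N → ℝ) (k : Fin N) (X Y : Mat N) :
    pairing ω k X Y = ∑ c, ∑ d, cutCoeff ω k c d *
      ((X d c).re * (Y d c).im - (X d c).im * (Y d c).re) := rfl

lemma pairing_self {N : ℕ} (ω : Fin N → ℝ) (k : Fin N) (X : Mat N) : pairing ω k X X = 0 := by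
  rw [pairing_apply]
  refine Finset.sum_eq_zero fun c _ => Finset.sum_eq_zero fun d _ => ?_
  ring

/-- Two different parameter families are allowed because the pairing at $k$ sees only `cutCoeff` and
the matrix entries in the block below the cut; this is what makes the change of $\omega_k$ possible.
-/
lemma pairing_congr {N : ℕ} {ω ω' : Fin N → ℝ} {k : Fin N} {X X' Y Y' : Mat N}
    (hω : ∀ c d, cutCoeff ω k c d = cutCoeff ω' k c d)
    (hX : ∀ c d, c ≤ k.castSucc → k.succ ≤ d → X d c = X' d c)
    (hY : ∀ c d, c ≤ k.castSucc → k.succ ≤ d → Y d c = Y' d c) :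
    pairing ω k X Y = pairing ω' k X' Y' := by
  rw [pairing_apply, pairing_apply]
  refine Finset.sum_congr rfl fun c _ => Finset.sum_congr rfl fun d _ => ?_
  by_cases h : c ≤ k.castSucc ∧ k.succ ≤ d
  · rw [hω, hX c d h.1 h.2, hY c d h.1 h.2]
  · rw [cutCoeff, cutCoeff, if_neg h, if_neg h, zero_mul, zero_mul]

lemma pairing_eq_zero {N : ℕ} (ω : Fin N → ℝ) (k : Fin N) {X Y : Mat N}
    (h : ∀ c d, c < d → X d c = 0 ∨ Y d c = 0) : pairing ω k X Y = 0 := by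
  rw [pairing_apply]
  refine Finset.sum_eq_zero fun c _ => Finset.sum_eq_zero fun d _ => ?_
  by_cases hcd : c < d
  · rcases h c d hcd with h | h <;> simp [h]
  · rw [cutCoeff_of_not_lt ω k hcd, zero_mul]

lemma matJ_lower {N : ℕ} (ω : Fin N → ℝ) {a b c d : Fin (N + 1)} (hab : a < b) (hcd : c < d) :
    matJ ω a b d c = if a = c ∧ b = d then 1 else 0 := by
  simp only [matJ, Matrix.add_apply, Matrix.single_apply]
  grind

lemma matM_lower {N : ℕ} (ω : Fin N → ℝ) {a b c d : Fin (N + 1)} (hab : a < b) (hcd : c < d) :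
    matM ω a b d c = if a = c ∧ b = d then Complex.I else 0 := by
  simp only [matM, Matrix.add_apply, Matrix.single_apply]
  grind

lemma pairing_matJ_matM {N : ℕ} (ω : Fin N → ℝ) (k : Fin N) {a b : Fin (N + 1)} (hab : a < b) :
    pairing ω k (matJ ω a b) (matM ω a b) = cutCoeff ω k a b := by
  have h : ∀ c d, cutCoeff ω k c d * ((matJ ω a b d c).re * (matM ω a b d c).im
      - (matJ ω a b d c).im * (matM ω a b d c).re) =
      if a = c then (if b = d then cutCoeff ω k a b else 0) else 0 := by
    intro c d
    by_cases hcd : c < d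
    · rw [matJ_lower ω hab hcd, matM_lower ω hab hcd]
      by_cases h1 : a = c <;> by_cases h2 : b = d <;> simp [h1, h2]
    · rw [cutCoeff_of_not_lt ω k hcd, zero_mul]
      grind
  simp [pairing_apply, h]

/-- In the partial trace of a commutator, products inside the block of indices below $k$ cancel by
antisymmetry. Only products across the cut survive; there `Good` expresses the upper entry by the
lower one with factor $-\omega_{cd}$, from which $\omega_k$ splits off. -/
lemma diagCoord_lie {N : ℕ} (ω : Fin N → ℝ) (k : Fin N) {X Y : Mat N} (hX : Good ω X)
    (hY : Good ω Y) : diagCoord k ⁅X, Y⁆ = -(2 * ω k) * pairing ω k X Y := by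
  set T : Fin (N + 1) → Fin (N + 1) → ℝ := fun c d => (X c d * Y d c - Y c d * X d c).im with hT
  have hskew : ∀ c d, T c d = -T d c := fun c d => by
    simp only [hT, ← Complex.neg_im]
    congr 1
    ring
  have h1 : diagCoord k ⁅X, Y⁆ = ∑ c, ∑ d, if c ≤ k.castSucc then T c d else 0 := by
    rw [diagCoord_apply]
    refine Finset.sum_congr rfl fun c _ => ?_
    split_ifs
    · rw [Ring.lie_def, Matrix.sub_apply, Matrix.mul_apply, Matrix.mul_apply,
        ← Finset.sum_sub_distrib, Complex.im_sum]
    · simp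
  have h2 : ∑ c, ∑ d, (if c ≤ k.castSucc ∧ d ≤ k.castSucc then T c d else 0) = 0 := by
    have e : ∑ c, ∑ d, (if c ≤ k.castSucc ∧ d ≤ k.castSucc then T c d else 0) =
        -∑ c, ∑ d, (if c ≤ k.castSucc ∧ d ≤ k.castSucc then T c d else 0) := by
      conv_lhs => rw [Finset.sum_comm]
      simp only [← Finset.sum_neg_distrib]
      refine Finset.sum_congr rfl fun c _ => Finset.sum_congr rfl fun d _ => ?_
      rw [hskew d c]
      by_cases hc : c ≤ k.castSucc <;> by_cases hd : d ≤ k.castSucc <;> simp [hc, hd]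
    linarith
  rw [h1, pairing_apply]
  -- The difference of the two sides equals the vanishing block sum `h2` term by term, so no further
  -- rearrangement of sums is needed.
  refine sub_eq_zero.1 (Eq.trans ?_ h2)
  simp only [← Finset.sum_sub_distrib, Finset.mul_sum]
  refine Finset.sum_congr rfl fun c _ => Finset.sum_congr rfl fun d _ => ?_
  by_cases hc : c ≤ k.castSucc
  · by_cases hd : d ≤ k.castSucc
    · have : ¬ k.succ ≤ d := not_le.2 (hd.trans_lt Fin.castSucc_lt_succ)
      simp [hc, hd, cutCoeff, this]
    · have hd' : k.succ ≤ d := Fin.castSucc_lt_iff_succ_le.1 (not_le.1 hd)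
      have hcd : c ≤ d := hc.trans (Fin.castSucc_lt_succ.le.trans hd')
      have e : T c d = -(2 * omega ω c d) *
          ((X d c).re * (Y d c).im - (X d c).im * (Y d c).re) := by
        simp only [hT]
        rw [hX.1 c d hcd, hY.1 c d hcd]
        simp
        ring
      simp only [hc, hd, and_false, if_true, if_false]
      rw [e, omega_eq_mul_cutCoeff ω hc hd']
      ring
  · simp [hc, cutCoeff]

/-! ### Deforming $\omega_k$ to $1$, and the cyclic identity for the pairing -/

/-- Replace the entries above the cut at `k` such that an element of `su ω` becomes an element of
the algebra in which `ω_k` is replaced by one. -/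
def deform {N : ℕ} (ω : Fin N → ℝ) (k : Fin N) (X : Mat N) : Mat N :=
  Matrix.of fun a b => if a ≤ k.castSucc ∧ k.succ ≤ b then
    -(cutCoeff ω k a b : ℂ) * star (X b a) else X a b

lemma omega_update_of_notMem {N : ℕ} (ω : Fin N → ℝ) (k : Fin N) (t : ℝ) {a b : Fin (N + 1)}
    (h : k ∉ between a b) : omega (Function.update ω k t) a b = omega ω a b := by
  refine Finset.prod_congr rfl fun s hs => ?_
  rw [Function.update_of_ne]
  rintro rfl
  exact h hs

lemma cutCoeff_update {N : ℕ} (ω : Fin N → ℝ) (k : Fin N) (t : ℝ) (c d : Fin (N + 1)) :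
    cutCoeff (Function.update ω k t) k c d = cutCoeff ω k c d := by
  rw [cutCoeff, cutCoeff, omega_update_of_notMem, omega_update_of_notMem]
  · rw [mem_between]
    exact fun h => h.1.not_gt Fin.castSucc_lt_succ
  · rw [mem_between]
    exact fun h => h.2.not_gt Fin.castSucc_lt_succ

lemma deform_lower {N : ℕ} (ω : Fin N → ℝ) (k : Fin N) (X : Mat N) {a b : Fin (N + 1)}
    (h : ¬(a ≤ k.castSucc ∧ k.succ ≤ b)) : deform ω k X a b = X a b := by
  rw [deform, Matrix.of_apply, if_neg h]

lemma good_deform {N : ℕ} (ω : Fin N → ℝ) (k : Fin N) {X : Mat N} (hX : Good ω X) :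
    Good (Function.update ω k 1) (deform ω k X) := by
  have hlow : ∀ {a b : Fin (N + 1)}, b ≤ a → deform ω k X a b = X a b := fun {a b} h =>
    deform_lower ω k X fun h' =>
      (h'.1.trans_lt (Fin.castSucc_lt_succ.trans_le (h'.2.trans h))).false
  refine ⟨fun a b hab => ?_, ?_⟩
  · rw [hlow hab]
    by_cases h : a ≤ k.castSucc ∧ k.succ ≤ b
    · rw [deform, Matrix.of_apply, if_pos h, omega_eq_mul_cutCoeff _ h.1 h.2, cutCoeff_update,
        Function.update_self, one_mul]
    · rw [deform_lower ω k X h, omega_update_of_notMem, hX.1 a b hab]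
      rwa [mem_between]
  · rw [← hX.2]
    exact Finset.sum_congr rfl fun c _ => hlow le_rfl

/-- An entry $(d,c)$ of a product with $c<k\le d$ uses only entries in row $d$ of the first factor
and column $c$ of the second. None of these lie in the upper block that `deform` alters, so the
deformation need not be a homomorphism on all of `su ω`. -/
lemma pairing_lie_deform {N : ℕ} (ω : Fin N → ℝ) (k : Fin N) (X Y Z : Mat N) :
    pairing ω k ⁅X, Y⁆ Z =
      pairing (Function.update ω k 1) k ⁅deform ω k X, deform ω k Y⁆ (deform ω k Z) := by
  have hnot : ∀ {c d : Fin (N + 1)}, c ≤ k.castSucc → k.succ ≤ d → ∀ e,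
      ¬(d ≤ k.castSucc ∧ k.succ ≤ e) ∧ ¬(e ≤ k.castSucc ∧ k.succ ≤ c) := by
    intro c d hc hd e
    exact ⟨fun h => (hd.trans h.1).not_gt Fin.castSucc_lt_succ,
      fun h => (h.2.trans hc).not_gt Fin.castSucc_lt_succ⟩
  refine pairing_congr (fun c d => (cutCoeff_update ω k 1 c d).symm) (fun c d hc hd => ?_)
    (fun c d hc hd => (deform_lower ω k Z (hnot hc hd c).1).symm)
  simp only [Ring.lie_def, Matrix.sub_apply, Matrix.mul_apply]
  congr 1 <;> refine Finset.sum_congr rfl fun e _ => ?_ <;>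
    rw [deform_lower ω k _ (hnot hc hd e).1, deform_lower ω k _ (hnot hc hd e).2]

/-- After deformation $\omega_k=1$, and there the pairing is $-\tfrac12$ times a diagonal coordinate
of the commutator. The cyclic sum is then that coordinate of the Jacobi identity, with no assumption
on the original $\omega_k$. -/
lemma pairing_jacobi {N : ℕ} (ω : Fin N → ℝ) (k : Fin N) {X Y Z : Mat N} (hX : Good ω X)
    (hY : Good ω Y) (hZ : Good ω Z) :
    pairing ω k ⁅X, Y⁆ Z + pairing ω k ⁅Y, Z⁆ X + pairing ω k ⁅Z, X⁆ Y = 0 := by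
  rw [pairing_lie_deform ω k X Y Z, pairing_lie_deform ω k Y Z X, pairing_lie_deform ω k Z X Y]
  have gX := good_deform ω k hX
  have gY := good_deform ω k hY
  have gZ := good_deform ω k hZ
  have e : ∀ {U V : Mat N}, Good (Function.update ω k 1) U → Good (Function.update ω k 1) V →
      pairing (Function.update ω k 1) k U V = -(1 / 2) * diagCoord k ⁅U, V⁆ := by
    intro U V hU hV
    rw [diagCoord_lie _ k hU hV, Function.update_self]
    ring
  rw [e (good_lie _ gX gY) gZ, e (good_lie _ gY gZ) gX, e (good_lie _ gZ gX) gY, ← mul_add,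
    ← mul_add, ← map_add, ← map_add]
  rw [lie_lie_add_cyclic, map_zero, mul_zero]

/-! ### The basis of generators and linear maps defined on it -/

/-- The generators as elements of `su ω`. -/
def suGen {N : ℕ} (ω : Fin N → ℝ) (i : GenIndex N) : su ω :=
  ⟨gen ω i, Submodule.subset_span ⟨i, rfl⟩⟩

/-- The basis of `su ω` consisting of the generators. -/
def suBasis {N : ℕ} (ω : Fin N → ℝ) : Module.Basis (GenIndex N) ℝ (su ω) :=
  Module.Basis.mk (v := suGen ω)
    (LinearIndependent.of_comp (su ω).toSubmodule.subtype (linearIndependent_gen ω)) (by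
      rintro ⟨x, hx⟩ -
      have hx' : x ∈ Submodule.span ℝ (Set.range (gen ω)) := hx
      induction hx' using Submodule.span_induction with
      | mem x h => obtain ⟨i, rfl⟩ := h; exact Submodule.subset_span ⟨i, rfl⟩
      | zero => exact Submodule.zero_mem _
      | add x y hx' hy' h1 h2 => exact Submodule.add_mem _ (h1 hx') (h2 hy')
      | smul r x hx' h => exact Submodule.smul_mem _ r (h hx'))

/-- The element `J_{ab}` of `su ω`. -/
def suJ {N : ℕ} (ω : Fin N → ℝ) {a b : Fin (N + 1)} (hab : a < b) : su ω :=
  suGen ω (Sum.inl ⟨(a, b), hab⟩)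

/-- The element `M_{ab}` of `su ω`. -/
def suM {N : ℕ} (ω : Fin N → ℝ) {a b : Fin (N + 1)} (hab : a < b) : su ω :=
  suGen ω (Sum.inr (Sum.inl ⟨(a, b), hab⟩))

/-- The element `B_l` of `su ω`. -/
def suB {N : ℕ} (ω : Fin N → ℝ) (l : Fin N) : su ω :=
  suGen ω (Sum.inr (Sum.inr l))

@[simp] lemma coe_suJ {N : ℕ} (ω : Fin N → ℝ) {a b : Fin (N + 1)} (hab : a < b) :
    (suJ ω hab : Mat N) = matJ ω a b := rfl

@[simp] lemma coe_suM {N : ℕ} (ω : Fin N → ℝ) {a b : Fin (N + 1)} (hab : a < b) :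
    (suM ω hab : Mat N) = matM ω a b := rfl

@[simp] lemma coe_suB {N : ℕ} (ω : Fin N → ℝ) (l : Fin N) : (suB ω l : Mat N) = matB l := rfl

/-- The inclusion of `su ω` into the matrices as a linear map. -/
def suIncl {N : ℕ} (ω : Fin N → ℝ) : su ω →ₗ[ℝ] Mat N := (su ω).toSubmodule.subtype

@[simp] lemma suIncl_apply {N : ℕ} (ω : Fin N → ℝ) (x : su ω) : suIncl ω x = (x : Mat N) := rfl

lemma good_coe {N : ℕ} {ω : Fin N → ℝ} (x : su ω) : Good ω (x : Mat N) :=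
  (mem_span_iff ω _).1 x.2

/-- There is a linear map on `su ω` with prescribed values at the generators. -/
lemma exists_linearMap {N : ℕ} (ω : Fin N → ℝ) {V : Type*} [AddCommGroup V] [Module ℝ V]
    (J M : Fin (N + 1) → Fin (N + 1) → V) (B : Fin N → V) :
    ∃ f : su ω →ₗ[ℝ] V, (∀ a b (hab : a < b), f (suJ ω hab) = J a b) ∧
      (∀ a b (hab : a < b), f (suM ω hab) = M a b) ∧ ∀ l, f (suB ω l) = B l := by
  let g : GenIndex N → V := Sum.elim (fun p => J p.1.1 p.1.2)
    (Sum.elim (fun p => M p.1.1 p.1.2) B)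
  have h : ∀ i, (suBasis ω).constr ℝ g (suGen ω i) = g i := fun i => by
    rw [← (suBasis ω).constr_basis ℝ g i, suBasis, Module.Basis.mk_apply]
  exact ⟨(suBasis ω).constr ℝ g, fun a b hab => h _, fun a b hab => h _, fun l => h _⟩

lemma linearMap_ext {N : ℕ} {ω : Fin N → ℝ} {V : Type*} [AddCommGroup V] [Module ℝ V]
    {f g : su ω →ₗ[ℝ] V} (hJ : ∀ a b (hab : a < b), f (suJ ω hab) = g (suJ ω hab))
    (hM : ∀ a b (hab : a < b), f (suM ω hab) = g (suM ω hab))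
    (hB : ∀ l, f (suB ω l) = g (suB ω l)) : f = g := by
  refine (suBasis ω).ext fun i => ?_
  rw [suBasis, Module.Basis.mk_apply]
  rcases i with ⟨⟨a, b⟩, hab⟩ | ⟨⟨a, b⟩, hab⟩ | l
  exacts [hJ a b hab, hM a b hab, hB l]

lemma diagCoord_matJ {N : ℕ} (ω : Fin N → ℝ) (k : Fin N) {a b : Fin (N + 1)} (hab : a < b) :
    diagCoord k (matJ ω a b) = 0 := diagCoord_eq_zero k (matJ_diag ω hab)

lemma diagCoord_matM {N : ℕ} (ω : Fin N → ℝ) (k : Fin N) {a b : Fin (N + 1)} (hab : a < b) :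
    diagCoord k (matM ω a b) = 0 := diagCoord_eq_zero k (matM_diag ω hab)

/-- The functionals `diagCoord k` kill the off-diagonal generators and are dual to the $B_l$, so
both sides agree on the basis. -/
lemma linearMap_eq_of_root_eq_zero {N : ℕ} {ω : Fin N → ℝ} {V : Type*} [AddCommGroup V]
    [Module ℝ V] (f : su ω →ₗ[ℝ] V) (hJ : ∀ a b (hab : a < b), f (suJ ω hab) = 0)
    (hM : ∀ a b (hab : a < b), f (suM ω hab) = 0) (x : su ω) :
    f x = ∑ k, diagCoord k (x : Mat N) • f (suB ω k) := by
  have h : f = ∑ k, ((diagCoord k).comp (suIncl ω)).smulRight (f (suB ω k)) := by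
    refine linearMap_ext (fun a b hab => ?_) (fun a b hab => ?_) (fun l => ?_)
    · rw [hJ, LinearMap.sum_apply]
      refine (Finset.sum_eq_zero fun k _ => ?_).symm
      simp [diagCoord_matJ ω k hab]
    · rw [hM, LinearMap.sum_apply]
      refine (Finset.sum_eq_zero fun k _ => ?_).symm
      simp [diagCoord_matM ω k hab]
    · simp [LinearMap.sum_apply, diagCoord_matB]
  conv_lhs => rw [h]
  simp [LinearMap.sum_apply]

/-! ### Two-cocycles and the standard cocycle -/

/-- A real-valued bilinear form on `su ω` is a two-cocycle (with trivial coefficients). -/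
structure IsCocycle {N : ℕ} {ω : Fin N → ℝ} (ψ : su ω →ₗ[ℝ] su ω →ₗ[ℝ] ℝ) : Prop where
  self : ∀ x, ψ x x = 0
  jacobi : ∀ x y z, ψ ⁅x, y⁆ z + ψ ⁅y, z⁆ x + ψ ⁅z, x⁆ y = 0

lemma IsCocycle.skew {N : ℕ} {ω : Fin N → ℝ} {ψ : su ω →ₗ[ℝ] su ω →ₗ[ℝ] ℝ} (h : IsCocycle ψ)
    (x y : su ω) : ψ x y = -ψ y x := by
  have e := h.self (x + y)
  simp only [map_add, LinearMap.add_apply, h.self] at e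
  linarith

lemma IsCocycle.sub {N : ℕ} {ω : Fin N → ℝ} {ψ φ : su ω →ₗ[ℝ] su ω →ₗ[ℝ] ℝ} (h : IsCocycle ψ)
    (h' : IsCocycle φ) : IsCocycle (ψ - φ) where
  self x := by simp [h.self, h'.self]
  jacobi x y z := by
    have e := h.jacobi x y z
    have e' := h'.jacobi x y z
    simp only [LinearMap.sub_apply]
    linarith

/-- The standard two-cocycle with coefficients `α`, `β`. -/
def stdForm {N : ℕ} (ω : Fin N → ℝ) (α : Fin N → ℝ) (β : Fin N → Fin N → ℝ) :
    su ω →ₗ[ℝ] su ω →ₗ[ℝ] ℝ :=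
  (∑ k, α k • pairing ω k + ∑ k, ∑ l, (if k < l then β k l else 0) •
    ((LinearMap.mul ℝ ℝ).compl₁₂ (diagCoord k) (diagCoord l)
      - (LinearMap.mul ℝ ℝ).compl₁₂ (diagCoord l) (diagCoord k))).compl₁₂
    (suIncl ω) (suIncl ω)

lemma stdForm_apply {N : ℕ} (ω : Fin N → ℝ) (α : Fin N → ℝ) (β : Fin N → Fin N → ℝ)
    (x y : su ω) : stdForm ω α β x y = ∑ k, α k * pairing ω k (x : Mat N) (y : Mat N) +
      ∑ k, ∑ l, (if k < l then β k l else 0) *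
        (diagCoord k (x : Mat N) * diagCoord l (y : Mat N)
          - diagCoord l (x : Mat N) * diagCoord k (y : Mat N)) := by
  simp only [stdForm, LinearMap.compl₁₂_apply, LinearMap.add_apply, LinearMap.sum_apply,
    LinearMap.smul_apply, LinearMap.sub_apply, LinearMap.mul_apply', suIncl_apply, smul_eq_mul]

lemma coe_lie {N : ℕ} {ω : Fin N → ℝ} (x y : su ω) :
    ((⁅x, y⁆ : su ω) : Mat N) = ⁅(x : Mat N), (y : Mat N)⁆ := rfl

lemma diagCoord_coe_lie {N : ℕ} {ω : Fin N → ℝ} (k : Fin N) (x y : su ω) :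
    diagCoord k ((⁅x, y⁆ : su ω) : Mat N) = -(2 * ω k) * pairing ω k (x : Mat N) (y : Mat N) :=
  diagCoord_lie ω k (good_coe x) (good_coe y)

/-- Diagonal coordinates of a commutator carry a factor $\omega_k$ or $\omega_l$, which
admissibility lets $\beta_{kl}$ annihilate. Hence the $\beta$ part contributes nothing to the cyclic
identity. -/
lemma stdForm_lie {N : ℕ} {ω : Fin N → ℝ} (α : Fin N → ℝ) {β : Fin N → Fin N → ℝ}
    (hβ : Admissible ω β) (x y z : su ω) :
    stdForm ω α β ⁅x, y⁆ z = ∑ k, α k * pairing ω k ⁅(x : Mat N), (y : Mat N)⁆ (z : Mat N) := by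
  rw [stdForm_apply, coe_lie, add_eq_left]
  refine Finset.sum_eq_zero fun k _ => Finset.sum_eq_zero fun l _ => ?_
  split_ifs with h
  · rw [← coe_lie, diagCoord_coe_lie, diagCoord_coe_lie]
    linear_combination (-2 * pairing ω k (x : Mat N) (y : Mat N) * diagCoord l (z : Mat N)) *
      (hβ k l h).1 + (2 * pairing ω l (x : Mat N) (y : Mat N) * diagCoord k (z : Mat N)) *
      (hβ k l h).2
  · rw [zero_mul]

lemma isCocycle_stdForm {N : ℕ} {ω : Fin N → ℝ} (α : Fin N → ℝ) {β : Fin N → Fin N → ℝ}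
    (hβ : Admissible ω β) : IsCocycle (stdForm ω α β) where
  self x := by
    rw [stdForm_apply]
    simp only [pairing_self, mul_zero, Finset.sum_const_zero, zero_add]
    refine Finset.sum_eq_zero fun k _ => Finset.sum_eq_zero fun l _ => ?_
    ring
  jacobi x y z := by
    rw [stdForm_lie α hβ, stdForm_lie α hβ, stdForm_lie α hβ, ← Finset.sum_add_distrib,
      ← Finset.sum_add_distrib]
    refine Finset.sum_eq_zero fun k _ => ?_
    rw [← mul_add, ← mul_add, pairing_jacobi ω k (good_coe x) (good_coe y) (good_coe z), mul_zero]

lemma pairing_matB {N : ℕ} (ω : Fin N → ℝ) (k l : Fin N) (X : Mat N) :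
    pairing ω k X (matB l) = 0 :=
  pairing_eq_zero ω k fun _ _ h => Or.inr (matB_of_ne l h.ne')

lemma stdForm_suJ_suB {N : ℕ} (ω : Fin N → ℝ) (α : Fin N → ℝ) (β : Fin N → Fin N → ℝ)
    {a b : Fin (N + 1)} (hab : a < b) (l : Fin N) :
    stdForm ω α β (suJ ω hab) (suB ω l) = 0 := by
  simp [stdForm_apply, diagCoord_matJ ω _ hab, pairing_matB]

lemma stdForm_suM_suB {N : ℕ} (ω : Fin N → ℝ) (α : Fin N → ℝ) (β : Fin N → Fin N → ℝ)
    {a b : Fin (N + 1)} (hab : a < b) (l : Fin N) :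
    stdForm ω α β (suM ω hab) (suB ω l) = 0 := by
  simp [stdForm_apply, diagCoord_matM ω _ hab, pairing_matB]

lemma stdForm_suB_suB {N : ℕ} (ω : Fin N → ℝ) (α : Fin N → ℝ) (β : Fin N → Fin N → ℝ)
    {k l : Fin N} (hkl : k < l) : stdForm ω α β (suB ω k) (suB ω l) = β k l := by
  have h : ∀ i j : Fin N, (if i < j then β i j else 0) *
      ((if i = k then (1 : ℝ) else 0) * (if j = l then 1 else 0)
        - (if j = k then 1 else 0) * (if i = l then 1 else 0)) =
      if k = i then (if l = j then β k l else 0) else 0 := by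
    intro i j
    by_cases h1 : k = i
    · subst h1
      by_cases h2 : l = j
      · subst h2
        simp [hkl, hkl.ne, hkl.ne']
      · simp [h2, Ne.symm h2, hkl.ne]
    · by_cases h2 : j = k ∧ i = l
      · rw [h2.1, h2.2]
        simp [hkl.not_gt, hkl.ne]
      · rw [not_and_or] at h2
        rcases h2 with h2 | h2 <;> simp [h2, h1, Ne.symm h1]
  simp only [stdForm_apply, coe_suB, pairing_matB, diagCoord_matB, mul_zero,
    Finset.sum_const_zero, zero_add, h]
  simp

lemma stdForm_suJ_suM {N : ℕ} (ω : Fin N → ℝ) (α : Fin N → ℝ) (β : Fin N → Fin N → ℝ)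
    {a b : Fin (N + 1)} (hab : a < b) : stdForm ω α β (suJ ω hab) (suM ω hab) =
      ∑ s ∈ between a b, omega ω a s.castSucc * omega ω s.succ b * α s := by
  simp only [stdForm_apply, coe_suJ, coe_suM, diagCoord_matJ ω _ hab, pairing_matJ_matM ω _ hab,
    zero_mul, sub_zero, mul_zero, Finset.sum_const_zero, add_zero]
  rw [between, Finset.sum_filter]
  refine Finset.sum_congr rfl fun k _ => ?_
  rw [cutCoeff]
  split_ifs <;> ring

lemma lower_disjoint {N : ℕ} {X Y : Mat N} {a b d e : Fin (N + 1)} {z w : ℂ}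
    (hX : ∀ i j, i < j → X j i = if a = i ∧ b = j then z else 0)
    (hY : ∀ i j, i < j → Y j i = if d = i ∧ e = j then w else 0) (h : ¬(a = d ∧ b = e))
    (i j : Fin (N + 1)) (hij : i < j) : X j i = 0 ∨ Y j i = 0 := by
  rw [hX i j hij, hY i j hij]
  grind

/-- The pairing vanishes on two root spaces which belong to different pairs of indices. -/
lemma pairing_root_root {N : ℕ} (ω : Fin N → ℝ) (k : Fin N) {a b d e : Fin (N + 1)} (hab : a < b)
    (hde : d < e) (h : ¬(a = d ∧ b = e)) :
    pairing ω k (matJ ω a b) (matJ ω d e) = 0 ∧ pairing ω k (matM ω a b) (matM ω d e) = 0 ∧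
      pairing ω k (matJ ω a b) (matM ω d e) = 0 ∧ pairing ω k (matM ω a b) (matJ ω d e) = 0 := by
  have J : ∀ {a b : Fin (N + 1)}, a < b → ∀ i j, i < j →
    matJ ω a b j i = if a = i ∧ b = j then 1 else 0 := fun h i j hij => matJ_lower ω h hij
  have M : ∀ {a b : Fin (N + 1)}, a < b → ∀ i j, i < j →
    matM ω a b j i = if a = i ∧ b = j then Complex.I else 0 := fun h i j hij => matM_lower ω h hij
  exact ⟨pairing_eq_zero ω k (lower_disjoint (J hab) (J hde) h),
    pairing_eq_zero ω k (lower_disjoint (M hab) (M hde) h),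
    pairing_eq_zero ω k (lower_disjoint (J hab) (M hde) h),
    pairing_eq_zero ω k (lower_disjoint (M hab) (J hde) h)⟩

lemma stdForm_root_root {N : ℕ} (ω : Fin N → ℝ) (α : Fin N → ℝ) (β : Fin N → Fin N → ℝ)
    {a b d e : Fin (N + 1)} (hab : a < b) (hde : d < e) (h : ¬(a = d ∧ b = e)) :
    stdForm ω α β (suJ ω hab) (suJ ω hde) = 0 ∧ stdForm ω α β (suM ω hab) (suM ω hde) = 0 ∧
      stdForm ω α β (suJ ω hab) (suM ω hde) = 0 ∧
      stdForm ω α β (suM ω hab) (suJ ω hde) = 0 := by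
  simp [stdForm_apply, diagCoord_matJ ω _ hab, diagCoord_matM ω _ hab,
    pairing_root_root ω _ hab hde h]

/-! ### A diagonal element with generic roots -/

lemma two_pow_add_ne {a b d e : ℕ} (hde : d < e) (hbe : b < e) :
    2 ^ b + 2 ^ d ≠ 2 ^ e + 2 ^ a := by
  obtain ⟨n, rfl⟩ : ∃ n, e = n + 1 := ⟨e - 1, by omega⟩
  -- Both exponents on the left are at most $e-1$, so the left side is at most $2^e$, while the
  -- right side exceeds $2^e$.
  have h1 : 2 ^ b ≤ 2 ^ n := Nat.pow_le_pow_right two_pos (by omega)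
  have h2 : 2 ^ d ≤ 2 ^ n := Nat.pow_le_pow_right two_pos (by omega)
  have h3 : 0 < 2 ^ a := by positivity
  rw [pow_succ]
  omega

lemma eq_of_two_pow_sub_eq {a b d e : ℕ} (hab : a < b) (hde : d < e)
    (h : (2 : ℝ) ^ b - 2 ^ a = 2 ^ e - 2 ^ d) : a = d ∧ b = e := by
  have h' : 2 ^ b + 2 ^ d = 2 ^ e + 2 ^ a := by
    have : (2 : ℝ) ^ b + 2 ^ d = 2 ^ e + 2 ^ a := by linarith
    exact_mod_cast this
  have hbe : b = e := by
    rcases lt_trichotomy b e with hl | he | hl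
    · exact absurd h' (two_pow_add_ne hde hl)
    · exact he
    · exact absurd h'.symm (two_pow_add_ne hab hl)
  subst hbe
  exact ⟨(Nat.pow_right_injective le_rfl (Nat.add_left_cancel h')).symm, rfl⟩

/-- There are diagonal matrices of trace zero all of whose roots have different absolute values. -/
lemma exists_generic_height (N : ℕ) : ∃ h : Fin (N + 1) → ℝ, ∑ c, h c = 0 ∧
    (∀ a b, a < b → h a - h b ≠ 0) ∧ ∀ a b d e, a < b → d < e →
      (h a - h b) ^ 2 = (h d - h e) ^ 2 → a = d ∧ b = e := by
  -- Powers of two have pairwise different positive differences; subtracting their mean makes the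
  -- trace zero without changing differences.
  set m : ℝ := (∑ c : Fin (N + 1), (2 : ℝ) ^ (c : ℕ)) / (N + 1) with hm
  have hpos : ∀ a b : Fin (N + 1), a < b → (2 : ℝ) ^ (a : ℕ) < 2 ^ (b : ℕ) := fun a b hab =>
    pow_lt_pow_right₀ one_lt_two hab
  refine ⟨fun c => 2 ^ (c : ℕ) - m, ?_, fun a b hab => ?_, fun a b d e hab hde h => ?_⟩
  · have hN : (N + 1 : ℝ) ≠ 0 := by positivity
    simp only [Finset.sum_sub_distrib, Finset.sum_const, Finset.card_univ, Fintype.card_fin,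
      nsmul_eq_mul, hm]
    push_cast
    rw [mul_div_cancel₀ _ hN, sub_self]
  · have := hpos a b hab
    intro h
    linarith
  · have h1 := hpos a b hab
    have h2 := hpos d e hde
    have h3 : (2 : ℝ) ^ (b : ℕ) - 2 ^ (a : ℕ) = 2 ^ (e : ℕ) - 2 ^ (d : ℕ) := by
      refine (sq_eq_sq₀ (by linarith) (by linarith)).1 ?_
      linarith
    obtain ⟨h4, h5⟩ := eq_of_two_pow_sub_eq hab hde h3
    exact ⟨Fin.ext h4, Fin.ext h5⟩

/-- The element `i diag(h)` of `su ω`. -/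
def suDiag {N : ℕ} (ω : Fin N → ℝ) (h : Fin (N + 1) → ℝ) (hh : ∑ c, h c = 0) : su ω :=
  ⟨Matrix.diagonal fun c => Complex.I * (h c : ℂ), by
    refine (mem_span_iff ω _).2 ⟨fun a b _ => ?_, ?_⟩
    · by_cases hab : a = b
      · subst hab
        simp [omega_self]
      · simp [hab, Ne.symm hab]
    · rw [Matrix.trace_diagonal, ← Finset.mul_sum, ← Complex.ofReal_sum, hh]
      simp⟩

/-! ### Brackets with diagonal elements -/

section Brackets

variable {N : ℕ} (ω : Fin N → ℝ)

lemma suJ_lie_suDiag {a b : Fin (N + 1)} (hab : a < b) (h : Fin (N + 1) → ℝ)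
    (hh : ∑ c, h c = 0) : ⁅suJ ω hab, suDiag ω h hh⁆ = (h a - h b) • suM ω hab := by
  refine Subtype.ext ?_
  change ⁅matJ ω a b, Matrix.diagonal fun c => Complex.I * (h c : ℂ)⁆ = (h a - h b) • matM ω a b
  ext i j
  simp only [Ring.lie_def, Matrix.sub_apply, Matrix.mul_diagonal, Matrix.diagonal_mul,
    Matrix.smul_apply, matJ, matM, Matrix.add_apply, Matrix.single_apply, Complex.real_smul]
  by_cases h1 : a = i ∧ b = j
  · obtain ⟨rfl, rfl⟩ := h1
    simp [hab.ne']
    ring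
  · by_cases h2 : b = i ∧ a = j
    · obtain ⟨rfl, rfl⟩ := h2
      simp [hab.ne]
      ring
    · simp [h1, h2]

lemma suM_lie_suDiag {a b : Fin (N + 1)} (hab : a < b) (h : Fin (N + 1) → ℝ)
    (hh : ∑ c, h c = 0) : ⁅suM ω hab, suDiag ω h hh⁆ = -((h a - h b) • suJ ω hab) := by
  refine Subtype.ext ?_
  change ⁅matM ω a b, Matrix.diagonal fun c => Complex.I * (h c : ℂ)⁆
    = -((h a - h b) • matJ ω a b)
  ext i j
  simp only [Ring.lie_def, Matrix.sub_apply, Matrix.mul_diagonal, Matrix.diagonal_mul,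
    Matrix.neg_apply,
    Matrix.smul_apply, matJ, matM, Matrix.add_apply, Matrix.single_apply, Complex.real_smul]
  by_cases h1 : a = i ∧ b = j
  · obtain ⟨rfl, rfl⟩ := h1
    simp [hab.ne']
    linear_combination (omega ω a b : ℂ) * (h b - h a) * Complex.I_sq
  · by_cases h2 : b = i ∧ a = j
    · obtain ⟨rfl, rfl⟩ := h2
      simp [hab.ne]
      linear_combination (h a - h b : ℂ) * Complex.I_sq
    · simp [h1, h2]

lemma suB_lie_suDiag (l : Fin N) (h : Fin (N + 1) → ℝ) (hh : ∑ c, h c = 0) :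
    ⁅suB ω l, suDiag ω h hh⁆ = 0 := by
  refine Subtype.ext ?_
  change ⁅(matB l : Mat N), Matrix.diagonal fun c => Complex.I * (h c : ℂ)⁆ = 0
  ext i j
  simp only [Ring.lie_def, Matrix.sub_apply, Matrix.mul_diagonal, Matrix.diagonal_mul,
    Matrix.zero_apply]
  by_cases hij : i = j
  · subst hij
    ring
  · rw [matB_of_ne l hij]
    ring

lemma suJ_lie_suB {a b : Fin (N + 1)} (hab : a < b) (l : Fin N) :
    ⁅suJ ω hab, suB ω l⁆ = rootCoeff a b l • suM ω hab :=
  Subtype.ext ((relations_su ω).JB a b l hab)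

lemma suM_lie_suB {a b : Fin (N + 1)} (hab : a < b) (l : Fin N) :
    ⁅suM ω hab, suB ω l⁆ = -(rootCoeff a b l • suJ ω hab) :=
  Subtype.ext ((relations_su ω).MB a b l hab)

lemma suB_lie_suB (k l : Fin N) : ⁅suB ω k, suB ω l⁆ = 0 := by
  have h : ∀ {k l : Fin N}, k < l → ⁅suB ω k, suB ω l⁆ = 0 := fun {k l} hkl =>
    Subtype.ext (((relations_su ω).BB k l hkl).trans (smul_zero _))
  rcases lt_trichotomy k l with hkl | rfl | hkl
  · exact h hkl
  · exact lie_self _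
  · rw [← lie_skew, h hkl, neg_zero]

lemma suJ_lie_suM {a b : Fin (N + 1)} (hab : a < b) :
    ⁅suJ ω hab, suM ω hab⁆ = -((2 * omega ω a b) • ∑ s ∈ between a b, suB ω s) := by
  refine Subtype.ext (((relations_su ω).JM a b hab).trans ?_)
  rw [smul_zero, add_zero]
  simp

/-- Projection to the diagonal kills every $J_{ab}$ and $M_{ab}$, and fixes each $B_l$ and the
element itself, so `linearMap_eq_of_root_eq_zero` applies to it. -/
lemma suDiag_eq_sum (h : Fin (N + 1) → ℝ) (hh : ∑ c, h c = 0) :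
    suDiag ω h hh = ∑ k, diagCoord k (suDiag ω h hh : Mat N) • suB ω k := by
  let D : Mat N →ₗ[ℝ] Mat N := (Matrix.diagonalLinearMap (Fin (N + 1)) ℝ ℂ).comp
    (Matrix.diagLinearMap (Fin (N + 1)) ℝ ℂ)
  have hD : ∀ X, D X = Matrix.diagonal fun c => X c c := fun X => rfl
  have hB : ∀ l : Fin N, D (matB l) = matB l := fun l => by
    ext i j
    rw [hD, Matrix.diagonal_apply]
    split_ifs with hij
    · rw [hij]
    · rw [matB_of_ne l hij]
  have key := linearMap_eq_of_root_eq_zero (D.comp (suIncl ω))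
    (fun a b hab => by simp [hD, matJ_diag ω hab]) (fun a b hab => by simp [hD, matM_diag ω hab])
    (suDiag ω h hh)
  refine Subtype.ext ?_
  have e : D.comp (suIncl ω) (suDiag ω h hh) = (suDiag ω h hh : Mat N) := by
    simp [hD, suDiag]
  refine e.symm.trans (key.trans ?_)
  simp [hB]

end Brackets

/-! ### Normalization and classification of cocycles -/

section Cocycles

variable {N : ℕ} {ω : Fin N → ℝ} {ψ : su ω →ₗ[ℝ] su ω →ₗ[ℝ] ℝ}

/-- The coboundary `(x, y) ↦ f ⁅x, y⁆`. -/
def coboundary (f : su ω →ₗ[ℝ] ℝ) : su ω →ₗ[ℝ] su ω →ₗ[ℝ] ℝ :=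
  (LieModule.toEnd ℝ (su ω) (su ω)).toLinearMap.compr₂ f

@[simp] lemma coboundary_apply (f : su ω →ₗ[ℝ] ℝ) (x y : su ω) : coboundary f x y = f ⁅x, y⁆ := rfl

lemma isCocycle_coboundary (f : su ω →ₗ[ℝ] ℝ) : IsCocycle (coboundary f) where
  self x := by simp
  jacobi x y z := by
    simp only [coboundary_apply, ← map_add, lie_lie_add_cyclic, map_zero]

/-- The cocycle vanishes if one argument is an off-diagonal generator and the other is diagonal. -/
def Normalized (ψ : su ω →ₗ[ℝ] su ω →ₗ[ℝ] ℝ) : Prop :=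
  ∀ a b (hab : a < b) l, ψ (suJ ω hab) (suB ω l) = 0 ∧ ψ (suM ω hab) (suB ω l) = 0

lemma Normalized.apply_suDiag (hn : Normalized ψ) (h : Fin (N + 1) → ℝ) (hh : ∑ c, h c = 0)
    {a b : Fin (N + 1)} (hab : a < b) :
    ψ (suJ ω hab) (suDiag ω h hh) = 0 ∧ ψ (suM ω hab) (suDiag ω h hh) = 0 := by
  rw [suDiag_eq_sum]
  simp [hn a b hab]

/-- Every cocycle is normalized after subtraction of a coboundary. -/
lemma IsCocycle.exists_normalized (hψ : IsCocycle ψ) :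
    ∃ f : su ω →ₗ[ℝ] ℝ, Normalized (ψ - coboundary f) := by
  obtain ⟨h, hh, hne, -⟩ := exists_generic_height N
  set H := suDiag ω h hh with hH
  -- Since $H$ sends $J_{ab}$ to $(h_a-h_b)M_{ab}$ and $M_{ab}$ to $-(h_a-h_b)J_{ab}$, these values
  -- of $f$ are forced by requiring the corrected cocycle to vanish on $(J_{ab},H)$ and
  -- $(M_{ab},H)$.
  obtain ⟨f, fJ, fM, -⟩ := exists_linearMap ω
    (fun a b => if hab : a < b then -(ψ (suM ω hab) H / (h a - h b)) else 0)
    (fun a b => if hab : a < b then ψ (suJ ω hab) H / (h a - h b) else 0) (fun _ => (0 : ℝ))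
  refine ⟨f, ?_⟩
  set φ := ψ - coboundary f with hφ
  have hc : IsCocycle φ := hψ.sub (isCocycle_coboundary f)
  have hJ : ∀ a b (hab : a < b), φ (suJ ω hab) H = 0 := fun a b hab => by
    have := hne a b hab
    rw [hφ, LinearMap.sub_apply, LinearMap.sub_apply, coboundary_apply, suJ_lie_suDiag, map_smul,
      fM, dif_pos hab, smul_eq_mul]
    field_simp
    ring
  have hM : ∀ a b (hab : a < b), φ (suM ω hab) H = 0 := fun a b hab => by
    have := hne a b hab
    rw [hφ, LinearMap.sub_apply, LinearMap.sub_apply, coboundary_apply, suM_lie_suDiag, map_neg,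
      map_smul, fJ, dif_pos hab, smul_eq_mul]
    field_simp
    ring
  intro a b hab l
  constructor
  · have e := hc.jacobi (suM ω hab) H (suB ω l)
    rw [suM_lie_suDiag, ← lie_skew H, suB_lie_suDiag, ← lie_skew (suB ω l), suM_lie_suB] at e
    simp only [neg_zero, neg_neg, map_neg, map_smul, map_zero, LinearMap.neg_apply,
      LinearMap.smul_apply, LinearMap.zero_apply, hJ, smul_zero, add_zero, neg_eq_zero,
      smul_eq_zero, hne a b hab, false_or] at e
    exact e
  · have e := hc.jacobi (suJ ω hab) H (suB ω l)
    rw [suJ_lie_suDiag, ← lie_skew H, suB_lie_suDiag, ← lie_skew (suB ω l), suJ_lie_suB] at e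
    simp only [neg_zero, map_neg, map_smul, map_zero, LinearMap.neg_apply,
      LinearMap.smul_apply, LinearMap.zero_apply, hM, smul_zero, add_zero,
      smul_eq_zero, hne a b hab, false_or] at e
    exact e

/-- A normalized cocycle vanishes on two different root spaces. -/
lemma Normalized.root_root (hn : Normalized ψ) (hψ : IsCocycle ψ) {a b d e : Fin (N + 1)}
    (hab : a < b) (hde : d < e) (hne : ¬(a = d ∧ b = e)) :
    ψ (suJ ω hab) (suJ ω hde) = 0 ∧ ψ (suM ω hab) (suM ω hde) = 0 ∧
      ψ (suJ ω hab) (suM ω hde) = 0 ∧ ψ (suM ω hab) (suJ ω hde) = 0 := by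
  obtain ⟨h, hh, -, hinj⟩ := exists_generic_height N
  set H := suDiag ω h hh with hH
  have hr : (h a - h b) ^ 2 - (h d - h e) ^ 2 ≠ 0 := fun h0 =>
    hne (hinj a b d e hab hde (sub_eq_zero.1 h0))
  -- The commutator of different root vectors has no diagonal part, so normalization removes the
  -- term $\psi([x,y],H)$ from the Jacobi identity. The action of $H$ can therefore be moved from
  -- one argument to the other.
  have hlie : ∀ x y : su ω, (∀ k, pairing ω k (x : Mat N) (y : Mat N) = 0) →
      ψ ⁅y, H⁆ x = ψ ⁅x, H⁆ y := by
    intro x y hxy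
    have e1 : ψ ⁅x, y⁆ H = 0 := by
      have := linearMap_eq_of_root_eq_zero (ψ.flip H)
        (fun a b hab => (hn.apply_suDiag h hh hab).1) (fun a b hab => (hn.apply_suDiag h hh hab).2) ⁅x, y⁆
      refine this.trans (Finset.sum_eq_zero fun k _ => ?_)
      rw [diagCoord_coe_lie, hxy, mul_zero, zero_smul]
    have e2 := hψ.jacobi x y H
    rw [e1, ← lie_skew H, map_neg, LinearMap.neg_apply] at e2
    linarith
  have hp := fun k => pairing_root_root ω k hab hde hne
  have h1 := hlie (suJ ω hab) (suJ ω hde) fun k => (hp k).1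
  have h2 := hlie (suM ω hab) (suM ω hde) fun k => (hp k).2.1
  have h3 := hlie (suJ ω hab) (suM ω hde) fun k => (hp k).2.2.1
  have h4 := hlie (suM ω hab) (suJ ω hde) fun k => (hp k).2.2.2
  simp only [hH, suJ_lie_suDiag, suM_lie_suDiag, map_neg, map_smul, LinearMap.neg_apply,
    LinearMap.smul_apply, smul_eq_mul] at h1 h2 h3 h4
  rw [hψ.skew (suM ω hde)] at h1 h4
  rw [hψ.skew (suJ ω hde)] at h2 h3
  -- The four relations form two linear systems of size two, one for the $JJ$ and $MM$ values and
  -- one for the mixed values, each with determinant $\pm\big((h_a-h_b)^2-(h_d-h_e)^2\big)$.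
  refine ⟨?_, ?_, ?_, ?_⟩ <;> refine (mul_eq_zero.1 ?_).resolve_left hr
  · linear_combination (h a - h b) * h4 - (h d - h e) * h3
  · linear_combination (-(h a - h b)) * h3 + (h d - h e) * h4
  · linear_combination (h a - h b) * h2 + (h d - h e) * h1
  · linear_combination (-(h a - h b)) * h1 - (h d - h e) * h2

/-- With $c=b-1>a$, the Jacobi identity for $J_{ac}$, $J_{cb}$, $M_{ab}$ expresses the value on
$(J_{ab},M_{ab})$ as $\omega_{cb}$ times that on $(J_{ac},M_{ac})$ plus $\omega_{ac}$ times that on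
$(J_{cb},M_{cb})$. Induction on $b$ descends to neighbouring indices. -/
lemma IsCocycle.suJ_suM_eq_zero (hψ : IsCocycle ψ)
    (hs : ∀ k : Fin N, ψ (suJ ω k.castSucc_lt_succ) (suM ω k.castSucc_lt_succ) = 0)
    {a b : Fin (N + 1)} (hab : a < b) : ψ (suJ ω hab) (suM ω hab) = 0 := by
  induction b using Fin.induction with
  | zero => exact absurd hab (Fin.not_lt_zero a)
  | succ l ih =>
    rcases (Fin.le_castSucc_iff.2 hab).eq_or_lt with rfl | hlt
    · exact hs l
    · have hl : l.castSucc < l.succ := l.castSucc_lt_succ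
      have e1 : ⁅suJ ω hlt, suJ ω hl⁆ = -suJ ω hab :=
        Subtype.ext ((relations_su ω).JJ_ab_bc a _ _ hlt hl)
      have e2 : ⁅suM ω hab, suJ ω hl⁆ = omega ω l.castSucc l.succ • suM ω hlt :=
        Subtype.ext ((relations_su ω).MJ_ac_bc a _ _ hlt hl)
      have e3 : ⁅suJ ω hlt, suM ω hab⁆ = omega ω a l.castSucc • suM ω hl :=
        Subtype.ext ((relations_su ω).JM_ab_ac a _ _ hlt hl)
      have e := hψ.jacobi (suJ ω hlt) (suJ ω hl) (suM ω hab)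
      rw [e1, ← lie_skew (suJ ω hl), e2, ← lie_skew (suM ω hab), e3] at e
      simp only [map_neg, map_smul, LinearMap.neg_apply, LinearMap.smul_apply, smul_eq_mul] at e
      rw [hψ.skew (suM ω hlt), hψ.skew (suM ω hl), ih hlt, hs l] at e
      linarith

lemma Normalized.eq_zero (hn : Normalized ψ) (hψ : IsCocycle ψ)
    (hs : ∀ k : Fin N, ψ (suJ ω k.castSucc_lt_succ) (suM ω k.castSucc_lt_succ) = 0)
    (hB : ∀ k l : Fin N, k < l → ψ (suB ω k) (suB ω l) = 0) : ψ = 0 := by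
  have hJM := fun {a b : Fin (N + 1)} (hab : a < b) => hψ.suJ_suM_eq_zero hs hab
  refine linearMap_ext (fun a b hab => ?_) (fun a b hab => ?_) (fun k => ?_) <;>
    refine linearMap_ext (fun d e hde => ?_) (fun d e hde => ?_) (fun l => ?_) <;>
    simp only [LinearMap.zero_apply]
  · by_cases h : a = d ∧ b = e
    · obtain ⟨rfl, rfl⟩ := h
      exact hψ.self _
    · exact (hn.root_root hψ hab hde h).1
  · by_cases h : a = d ∧ b = e
    · obtain ⟨rfl, rfl⟩ := h
      exact hJM hab
    · exact (hn.root_root hψ hab hde h).2.2.1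
  · exact (hn a b hab l).1
  · by_cases h : a = d ∧ b = e
    · obtain ⟨rfl, rfl⟩ := h
      rw [hψ.skew, hJM hab, neg_zero]
    · exact (hn.root_root hψ hab hde h).2.2.2
  · by_cases h : a = d ∧ b = e
    · obtain ⟨rfl, rfl⟩ := h
      exact hψ.self _
    · exact (hn.root_root hψ hab hde h).2.1
  · exact (hn a b hab l).2
  · rw [hψ.skew, (hn d e hde k).1, neg_zero]
  · rw [hψ.skew, (hn d e hde k).2, neg_zero]
  · rcases lt_trichotomy k l with h | rfl | h
    · exact hB k l h
    · exact hψ.self _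
    · rw [hψ.skew, hB l k h, neg_zero]

/-- In the Jacobi identity for $J_{k-1,k}$, $M_{k-1,k}$, $B_l$, the first bracket is
$-2\omega_kB_k$, and the other two terms are multiples of $\psi(J,J)$ and $\psi(M,M)$, hence zero.
The second condition follows by exchanging $k$ and $l$. -/
lemma IsCocycle.admissible (hψ : IsCocycle ψ) :
    Admissible ω fun k l => ψ (suB ω k) (suB ω l) := by
  have key : ∀ k l, ω k * ψ (suB ω k) (suB ω l) = 0 := by
    intro k l
    have hk := k.castSucc_lt_succ
    have e := hψ.jacobi (suJ ω hk) (suM ω hk) (suB ω l)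
    rw [suJ_lie_suM, suM_lie_suB, ← lie_skew (suB ω l), suJ_lie_suB, between_step, omega_step,
      Finset.sum_singleton] at e
    simp only [map_neg, map_smul, LinearMap.neg_apply, LinearMap.smul_apply, hψ.self,
      smul_eq_mul] at e
    linarith
  exact fun k l _ => ⟨key k l, by
    have := key l k
    rwa [hψ.skew, mul_neg, neg_eq_zero] at this⟩

lemma normalized_stdForm (α : Fin N → ℝ) (β : Fin N → Fin N → ℝ) :
    Normalized (stdForm ω α β) :=
  fun _ _ hab l => ⟨stdForm_suJ_suB ω α β hab l, stdForm_suM_suB ω α β hab l⟩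

lemma stdForm_suJ_suM_step (α : Fin N → ℝ) (β : Fin N → Fin N → ℝ) (k : Fin N) :
    stdForm ω α β (suJ ω k.castSucc_lt_succ) (suM ω k.castSucc_lt_succ) = α k := by
  rw [stdForm_suJ_suM, between_step, Finset.sum_singleton, omega_self, omega_self, one_mul,
    one_mul]

/-- A normalized cocycle is determined by its coefficients. -/
lemma Normalized.eq_stdForm (hn : Normalized ψ) (hψ : IsCocycle ψ) {α : Fin N → ℝ}
    {β : Fin N → Fin N → ℝ}
    (hα : ∀ k : Fin N, ψ (suJ ω k.castSucc_lt_succ) (suM ω k.castSucc_lt_succ) = α k)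
    (hβ : ∀ k l : Fin N, k < l → ψ (suB ω k) (suB ω l) = β k l) :
    Admissible ω β ∧ ψ = stdForm ω α β := by
  have had : Admissible ω β := fun k l hkl => by
    rw [← hβ k l hkl]
    exact hψ.admissible k l hkl
  refine ⟨had, sub_eq_zero.1 (Normalized.eq_zero (fun a b hab l => ?_)
    (hψ.sub (isCocycle_stdForm α had)) (fun k => ?_) fun k l hkl => ?_)⟩
  · simp [hn a b hab l, normalized_stdForm α β a b hab l]
  · simp [hα, stdForm_suJ_suM_step]
  · simp [hβ k l hkl, stdForm_suB_suB ω α β hkl]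

end Cocycles

/-! ### Sections of extensions, their cocycles, and lifts of the generators -/

section Extensions

variable {N : ℕ} {ω : Fin N → ℝ}

/-- The linear section `s` of the extension `E` has the two-cocycle `ψ`. -/
structure Realizes (E : Ext.{u} ω) (s : su ω →ₗ[ℝ] E.L) (ψ : su ω →ₗ[ℝ] su ω →ₗ[ℝ] ℝ) :
    Prop where
  proj : ∀ x, E.proj (s x) = x
  lie : ∀ x y, ⁅s x, s y⁆ = s ⁅x, y⁆ + ψ x y • E.incl 1

variable {E : Ext.{u} ω}

lemma incl_eq_smul (E : Ext.{u} ω) (t : ℝ) : E.incl t = t • E.incl 1 := by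
  rw [← map_smul, smul_eq_mul, mul_one]

lemma smul_incl_one_injective (E : Ext.{u} ω) :
    Function.Injective fun t : ℝ => t • E.incl 1 := fun t r h =>
  E.incl_injective (by rw [incl_eq_smul E t, incl_eq_smul E r]; exact h)

lemma exists_smul_of_proj_eq_zero (E : Ext.{u} ω) {x : E.L} (h : E.proj x = 0) :
    ∃ t : ℝ, x = t • E.incl 1 := by
  have h1 : x ∈ E.incl.range := by
    rw [E.IsExtension.exact]
    exact h
  obtain ⟨t, ht⟩ := h1
  exact ⟨t, by rw [← incl_eq_smul]; exact ht.symm⟩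

lemma IsCentral.incl_one_lie (hE : IsCentral E) (x : E.L) : ⁅E.incl 1, x⁆ = 0 := hE 1 x

lemma IsCentral.lie_incl_one (hE : IsCentral E) (x : E.L) : ⁅x, E.incl 1⁆ = 0 := by
  rw [← lie_skew, hE 1 x, neg_zero]

lemma Realizes.isCocycle {s : su ω →ₗ[ℝ] E.L} {ψ : su ω →ₗ[ℝ] su ω →ₗ[ℝ] ℝ}
    (h : Realizes E s ψ) (hE : IsCentral E) : IsCocycle ψ where
  self x := by
    apply smul_incl_one_injective E
    have e := h.lie x x
    rw [lie_self, lie_self, map_zero, zero_add] at e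
    simpa using e.symm
  jacobi x y z := by
    apply smul_incl_one_injective E
    have key : ∀ x y z : su ω, ⁅⁅s x, s y⁆, s z⁆ = s ⁅⁅x, y⁆, z⁆ + ψ ⁅x, y⁆ z • E.incl 1 := by
      intro x y z
      rw [h.lie x y, add_lie, h.lie, smul_lie, hE.incl_one_lie, smul_zero, add_zero]
    have e := lie_lie_add_cyclic (s x) (s y) (s z)
    have e' := congrArg s (lie_lie_add_cyclic x y z)
    rw [map_add, map_add, map_zero] at e'
    rw [key, key, key] at e
    simp only [add_smul, zero_smul]
    rw [← e, ← sub_eq_zero, ← neg_eq_zero, ← e']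
    abel

/-- The defect of $s$ from being a homomorphism lies in $\ker\mathrm{proj}=\mathbb R\,\Xi$, and
bilinearity of its coefficient is inherited because $t\mapsto t\,\Xi$ is injective. -/
lemma exists_realizes (E : Ext.{u} ω) {s : su ω →ₗ[ℝ] E.L} (hs : ∀ x, E.proj (s x) = x) :
    ∃ ψ, Realizes E s ψ := by
  have h : ∀ x y, ∃ t : ℝ, ⁅s x, s y⁆ - s ⁅x, y⁆ = t • E.incl 1 := fun x y =>
    exists_smul_of_proj_eq_zero E (by rw [map_sub, LieHom.map_lie, hs, hs, hs, sub_self])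
  choose ψ hψ using h
  have hinj := smul_incl_one_injective E
  refine ⟨LinearMap.mk₂ ℝ ψ (fun x x' y => hinj ?_) (fun r x y => hinj ?_)
    (fun x y y' => hinj ?_) (fun r x y => hinj ?_), hs, fun x y => ?_⟩
  · simp only [add_smul, ← hψ, add_lie, map_add]
    abel
  · simp only [smul_assoc, ← hψ, smul_lie, map_smul, smul_sub]
  · simp only [add_smul, ← hψ, lie_add, map_add]
    abel
  · simp only [smul_assoc, ← hψ, lie_smul, map_smul, smul_sub]
  · rw [LinearMap.mk₂_apply, ← hψ]
    abel

/-- Adding central elements leaves the brackets of the lifts unchanged, but shifts the lift of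
$[x,y]$ by $f([x,y])\,\Xi$; this explains the minus sign. -/
lemma Realizes.add_smulRight {s : su ω →ₗ[ℝ] E.L} {ψ : su ω →ₗ[ℝ] su ω →ₗ[ℝ] ℝ}
    (h : Realizes E s ψ) (hE : IsCentral E) (f : su ω →ₗ[ℝ] ℝ) :
    Realizes E (s + f.smulRight (E.incl 1)) (ψ - coboundary f) where
  proj x := by
    rw [LinearMap.add_apply, LinearMap.smulRight_apply, map_add, map_smul, h.proj,
      LieAlgebra.Extension.proj_incl, smul_zero, add_zero]
  lie x y := by
    simp only [LinearMap.add_apply, LinearMap.smulRight_apply, lie_add, add_lie, lie_smul,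
      smul_lie, hE.incl_one_lie, hE.lie_incl_one, smul_zero, add_zero, h.lie,
      LinearMap.sub_apply, coboundary_apply, sub_smul]
    abel

lemma exists_section (E : Ext.{u} ω) : ∃ s : su ω →ₗ[ℝ] E.L, ∀ x, E.proj (s x) = x := by
  obtain ⟨s, hs⟩ := LinearMap.exists_rightInverse_of_surjective (E.proj : E.L →ₗ[ℝ] su ω)
    (LinearMap.range_eq_top.2 E.proj_surjective)
  exact ⟨s, fun x => LinearMap.congr_fun hs x⟩

/-- A linear section with the standard cocycle gives lifts of the generators which satisfy the
relations. -/
lemma Realizes.hasCoeffs {s : su ω →ₗ[ℝ] E.L} {α : Fin N → ℝ} {β : Fin N → Fin N → ℝ}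
    (h : Realizes E s (stdForm ω α β)) : HasCoeffs E α β := by
  -- The default value $0$ is harmless: neither `HasCoeffs` nor `Relations` constrains pairs that
  -- are not increasing.
  set J : Fin (N + 1) → Fin (N + 1) → E.L := fun a b =>
    if hab : a < b then s (suJ ω hab) else 0 with hJdef
  set M : Fin (N + 1) → Fin (N + 1) → E.L := fun a b =>
    if hab : a < b then s (suM ω hab) else 0 with hMdef
  have hJ : ∀ {a b} (hab : a < b), J a b = s (suJ ω hab) := fun hab => dif_pos hab
  have hM : ∀ {a b} (hab : a < b), M a b = s (suM ω hab) := fun hab => dif_pos hab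
  -- A matrix relation lifts without a central term wherever the standard cocycle vanishes on its
  -- two arguments. This covers every relation except those for $[J_{ab},M_{ab}]$ and $[B_k,B_l]$.
  have hlie : ∀ {x y z : su ω}, stdForm ω α β x y = 0 →
      ⁅(x : Mat N), (y : Mat N)⁆ = (z : Mat N) → ⁅s x, s y⁆ = s z := by
    intro x y z h0 hxy
    rw [h.lie, h0, zero_smul, add_zero]
    exact congrArg s (Subtype.ext hxy)
  have hR := relations_su ω
  have hst := fun {a b d e : Fin (N + 1)} (hab : a < b) (hde : d < e) (hne : ¬(a = d ∧ b = e)) =>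
    stdForm_root_root ω α β hab hde hne
  refine ⟨J, M, fun l => s (suB ω l), fun a b hab => ?_, fun a b hab => ?_, fun l => ?_, ?_⟩
  · rw [hJ hab, h.proj, coe_suJ]
  · rw [hM hab, h.proj, coe_suM]
  · rw [h.proj, coe_suB]
  constructor
  case JJ_ab_ac =>
    intro a b c hab hbc
    rw [hJ hab, hJ (hab.trans hbc), hJ hbc, ← map_smul]
    exact hlie (hst _ _ fun h => hbc.ne h.2).1 (hR.JJ_ab_ac a b c hab hbc)
  case JJ_ab_bc =>
    intro a b c hab hbc
    rw [hJ hab, hJ (hab.trans hbc), hJ hbc, ← map_neg]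
    exact hlie (hst _ _ fun h => hbc.ne h.2).1 (hR.JJ_ab_bc a b c hab hbc)
  case JJ_ac_bc =>
    intro a b c hab hbc
    rw [hJ hab, hJ (hab.trans hbc), hJ hbc, ← map_smul]
    exact hlie (hst _ _ fun h => hab.ne h.1).1 (hR.JJ_ac_bc a b c hab hbc)
  case MM_ab_ac =>
    intro a b c hab hbc
    rw [hM hab, hM (hab.trans hbc), hJ hbc, ← map_smul]
    exact hlie (hst _ _ fun h => hbc.ne h.2).2.1 (hR.MM_ab_ac a b c hab hbc)
  case MM_ab_bc =>
    intro a b c hab hbc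
    rw [hM hab, hJ (hab.trans hbc), hM hbc]
    exact hlie (hst _ _ fun h => hbc.ne h.2).2.1 (hR.MM_ab_bc a b c hab hbc)
  case MM_ac_bc =>
    intro a b c hab hbc
    rw [hJ hab, hM (hab.trans hbc), hM hbc, ← map_smul]
    exact hlie (hst _ _ fun h => hab.ne h.1).2.1 (hR.MM_ac_bc a b c hab hbc)
  case JM_ab_ac =>
    intro a b c hab hbc
    rw [hJ hab, hM (hab.trans hbc), hM hbc, ← map_smul]
    exact hlie (hst _ _ fun h => hbc.ne h.2).2.2.1 (hR.JM_ab_ac a b c hab hbc)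
  case JM_ab_bc =>
    intro a b c hab hbc
    rw [hJ hab, hM (hab.trans hbc), hM hbc, ← map_neg]
    exact hlie (hst _ _ fun h => hbc.ne h.2).2.2.1 (hR.JM_ab_bc a b c hab hbc)
  case JM_ac_bc =>
    intro a b c hab hbc
    rw [hM hab, hJ (hab.trans hbc), hM hbc, ← map_smul, ← map_neg]
    exact hlie (hst _ _ fun h => hab.ne h.1).2.2.1 (hR.JM_ac_bc a b c hab hbc)
  case MJ_ab_ac =>
    intro a b c hab hbc
    rw [hM hab, hJ (hab.trans hbc), hM hbc, ← map_smul, ← map_neg]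
    exact hlie (hst _ _ fun h => hbc.ne h.2).2.2.2 (hR.MJ_ab_ac a b c hab hbc)
  case MJ_ab_bc =>
    intro a b c hab hbc
    rw [hM hab, hM (hab.trans hbc), hJ hbc, ← map_neg]
    exact hlie (hst _ _ fun h => hbc.ne h.2).2.2.2 (hR.MJ_ab_bc a b c hab hbc)
  case MJ_ac_bc =>
    intro a b c hab hbc
    rw [hM hab, hM (hab.trans hbc), hJ hbc, ← map_smul]
    exact hlie (hst _ _ fun h => hab.ne h.1).2.2.2 (hR.MJ_ac_bc a b c hab hbc)
  case JJ_ab_de =>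
    intro a b d e hab hde h1 h2 h3 h4
    rw [hJ hab, hJ hde, ← map_zero s]
    exact hlie (hst _ _ fun h => h1 h.1).1 (hR.JJ_ab_de a b d e hab hde h1 h2 h3 h4)
  case MM_ab_de =>
    intro a b d e hab hde h1 h2 h3 h4
    rw [hM hab, hM hde, ← map_zero s]
    exact hlie (hst _ _ fun h => h1 h.1).2.1 (hR.MM_ab_de a b d e hab hde h1 h2 h3 h4)
  case JM_ab_de =>
    intro a b d e hab hde h1 h2 h3 h4
    rw [hJ hab, hM hde, ← map_zero s]
    exact hlie (hst _ _ fun h => h1 h.1).2.2.1 (hR.JM_ab_de a b d e hab hde h1 h2 h3 h4)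
  case JB =>
    intro a b l hab
    rw [hJ hab, hM hab, ← map_smul]
    exact hlie (stdForm_suJ_suB ω α β hab l) (hR.JB a b l hab)
  case MB =>
    intro a b l hab
    rw [hJ hab, hM hab, ← map_smul, ← map_neg]
    exact hlie (stdForm_suM_suB ω α β hab l) (hR.MB a b l hab)
  case JM =>
    intro a b hab
    rw [hJ hab, hM hab, h.lie, stdForm_suJ_suM, suJ_lie_suM, map_neg, map_smul, map_sum]
  case BB =>
    intro k l hkl
    rw [h.lie, stdForm_suB_suB ω α β hkl, suB_lie_suB, map_zero, zero_add]

/-- An extension with coefficients `α`, `β` has a linear section whose cocycle is the standard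
one. -/
lemma HasCoeffs.exists_realizes {α : Fin N → ℝ} {β : Fin N → Fin N → ℝ} (hE : IsCentral E)
    (h : HasCoeffs E α β) : Admissible ω β ∧ ∃ s, Realizes E s (stdForm ω α β) := by
  obtain ⟨J, M, B, pJ, pM, pB, hR⟩ := h
  obtain ⟨s, sJ, sM, sB⟩ := exists_linearMap ω J M B
  have hs : ∀ x, E.proj (s x) = x := by
    have : (E.proj : E.L →ₗ[ℝ] su ω).comp s = LinearMap.id := by
      refine linearMap_ext (fun a b hab => ?_) (fun a b hab => ?_) (fun l => ?_)
      · exact Subtype.ext ((congrArg (fun x => (E.proj x : Mat N)) (sJ a b hab)).trans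
          (pJ a b hab))
      · exact Subtype.ext ((congrArg (fun x => (E.proj x : Mat N)) (sM a b hab)).trans
          (pM a b hab))
      · exact Subtype.ext ((congrArg (fun x => (E.proj x : Mat N)) (sB l)).trans (pB l))
    exact fun x => LinearMap.congr_fun this x
  obtain ⟨ψ, hψ⟩ := CK.exists_realizes E hs
  have hinj := smul_incl_one_injective E
  -- The relations for $[J_{ab},B_l]$ and $[M_{ab},B_l]$ contain no central term, which is precisely
  -- normalization. After that, only neighbouring $[J,M]$ brackets and the $[B_k,B_l]$ are needed to
  -- identify $\psi$.
  have hn : Normalized ψ := by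
    intro a b hab l
    constructor <;> apply hinj
    · have e := hψ.lie (suJ ω hab) (suB ω l)
      rw [suJ_lie_suB, map_smul, sJ, sM, sB, hR.JB a b l hab, left_eq_add] at e
      simpa using e
    · have e := hψ.lie (suM ω hab) (suB ω l)
      rw [suM_lie_suB, map_neg, map_smul, sJ, sM, sB, hR.MB a b l hab, left_eq_add] at e
      simpa using e
  suffices h : Admissible ω β ∧ ψ = stdForm ω α β from ⟨h.1, s, h.2 ▸ hψ⟩
  refine hn.eq_stdForm (hψ.isCocycle hE) (fun k => hinj ?_) (fun k l hkl => hinj ?_)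
  · have e := hψ.lie (suJ ω k.castSucc_lt_succ) (suM ω k.castSucc_lt_succ)
    rw [suJ_lie_suM, map_neg, map_smul, map_sum, sJ, sM, hR.JM _ _ k.castSucc_lt_succ] at e
    simp only [sB] at e
    have e' := add_left_cancel e
    rw [between_step, Finset.sum_singleton, omega_self, omega_self, one_mul, one_mul] at e'
    exact e'.symm
  · have e := hψ.lie (suB ω k) (suB ω l)
    rw [suB_lie_suB, map_zero, zero_add, sB, sB, hR.BB k l hkl] at e
    exact e.symm

/-- Every central extension has some coefficients. -/
lemma IsCentral.exists_hasCoeffs (hE : IsCentral E) : ∃ α β, HasCoeffs E α β := by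
  obtain ⟨s, hs⟩ := exists_section E
  obtain ⟨ψ, hψ⟩ := exists_realizes E hs
  obtain ⟨f, hf⟩ := (hψ.isCocycle hE).exists_normalized
  have h := hψ.add_smulRight hE f
  obtain ⟨-, e⟩ := hf.eq_stdForm (h.isCocycle hE) (fun _ => rfl) (fun _ _ _ => rfl)
  rw [e] at h
  exact ⟨_, _, h.hasCoeffs⟩

/-! ### Realizing cocycles by extensions, and equivalence -/

/-- Every cocycle is the cocycle of a central extension. -/
lemma IsCocycle.exists_extension {ψ : su ω →ₗ[ℝ] su ω →ₗ[ℝ] ℝ} (hψ : IsCocycle ψ) :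
    ∃ E : Ext.{0} ω, IsCentral E ∧ ∃ s, Realizes E s ψ := by
  -- Central extensions correspond to the trivial action on $\mathbb R$, which is installed here by
  -- hand.
  let _ : LieRingModule (su ω) ℝ :=
    { bracket := fun _ _ => 0
      add_lie := fun _ _ _ => (add_zero 0).symm
      lie_add := fun _ _ _ => (add_zero 0).symm
      leibniz_lie := fun _ _ _ => (add_zero 0).symm }
  have : LieModule.IsTrivial (su ω) ℝ := ⟨fun _ _ => rfl⟩
  have : LieModule ℝ (su ω) ℝ :=
    { smul_lie := fun t _ _ => (smul_zero t).symm
      lie_smul := fun t _ _ => (smul_zero t).symm }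
  have : IsLieAbelian ℝ := ⟨fun x y => by rw [Ring.lie_def, mul_comm, sub_self]⟩
  let c : LieModule.Cohomology.twoCocycle ℝ (su ω) ℝ := ⟨⟨ψ, hψ.self⟩, by
    rw [LieModule.Cohomology.mem_twoCocycle_iff_of_trivial]
    intro x y z
    change ψ x ⁅y, z⁆ = ψ ⁅x, y⁆ z + ψ y ⁅x, z⁆
    have e := hψ.jacobi x y z
    rw [← lie_skew z x, map_neg, LinearMap.neg_apply] at e
    rw [hψ.skew x, hψ.skew y]
    linarith⟩
  let E : Ext.{0} ω := LieAlgebra.Extension.ofTwoCocycle c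
  have hbr : ∀ x y : su ω × ℝ, ⁅LieAlgebra.ofProd c x, LieAlgebra.ofProd c y⁆ =
      LieAlgebra.ofProd c (⁅x.1, y.1⁆, ψ x.1 y.1) := fun x y => by
    refine (LieAlgebra.bracket_ofTwoCocycle _ _).trans ?_
    change (⟨(⁅x.1, y.1⁆, ψ x.1 y.1 + 0 - 0)⟩ : LieAlgebra.ofTwoCocycle c) = _
    rw [add_zero, sub_zero]
    rfl
  refine ⟨E, fun t x => ?_, ⟨⟨fun x => (⟨(x, 0)⟩ : LieAlgebra.ofTwoCocycle c), fun x y => ?_⟩,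
    fun r x => ?_⟩, fun x => rfl, fun x y => ?_⟩
  · refine (hbr (0, t) x.carrier).trans ?_
    rw [zero_lie, map_zero]
    rfl
  · change (⟨(x + y, 0)⟩ : LieAlgebra.ofTwoCocycle c) = ⟨(x + y, 0 + 0)⟩
    rw [add_zero]
  · change (⟨(r • x, 0)⟩ : LieAlgebra.ofTwoCocycle c) = ⟨(r • x, r • 0)⟩
    rw [smul_zero]
  · refine (hbr (x, 0) (y, 0)).trans ?_
    change _ = (⟨(⁅x, y⁆ + ψ x y • 0, 0 + ψ x y • 1)⟩ : LieAlgebra.ofTwoCocycle c)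
    rw [smul_zero, add_zero, zero_add, smul_eq_mul, mul_one]
    rfl

/-- The underlying vector space of an extension with a linear section `s` is `su ω × ℝ`. -/
lemma Realizes.exists_linearEquiv {s : su ω →ₗ[ℝ] E.L} {ψ : su ω →ₗ[ℝ] su ω →ₗ[ℝ] ℝ}
    (hs : Realizes E s ψ) :
    ∃ e : (su ω × ℝ) ≃ₗ[ℝ] E.L, ∀ y t, e (y, t) = s y + t • E.incl 1 := by
  let g : su ω × ℝ →ₗ[ℝ] E.L := s.coprod (LinearMap.toSpanSingleton ℝ E.L (E.incl 1))
  have hg : ∀ y t, g (y, t) = s y + t • E.incl 1 := fun y t => by simp [g]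
  have hp : ∀ y t, E.proj (g (y, t)) = y := fun y t => by
    rw [hg, map_add, map_smul, hs.proj, LieAlgebra.Extension.proj_incl, smul_zero, add_zero]
  refine ⟨LinearEquiv.ofBijective g ⟨?_, fun x => ?_⟩, hg⟩
  · rintro ⟨y, t⟩ ⟨y', t'⟩ h
    have hy : y = y' := by rw [← hp y t, h, hp]
    subst hy
    rw [hg, hg] at h
    rw [smul_incl_one_injective E (add_left_cancel h)]
  · obtain ⟨t, ht⟩ := exists_smul_of_proj_eq_zero E (x := x - s (E.proj x))
      (by rw [map_sub, hs.proj, sub_self])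
    refine ⟨(E.proj x, t), ?_⟩
    rw [hg, ← ht]
    abel

/-- Two central extensions having linear sections with the same cocycle are equivalent. -/
lemma Realizes.equivalent {F : Ext.{v} ω} {ψ : su ω →ₗ[ℝ] su ω →ₗ[ℝ] ℝ} {s : su ω →ₗ[ℝ] E.L}
    {s' : su ω →ₗ[ℝ] F.L} (hs : Realizes E s ψ) (hs' : Realizes F s' ψ) (hE : IsCentral E)
    (hF : IsCentral F) : Equivalent E F := by
  obtain ⟨e, he⟩ := hs.exists_linearEquiv
  obtain ⟨e', he'⟩ := hs'.exists_linearEquiv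
  -- In the coordinates $su_\omega\times\mathbb R$ the bracket depends on $\psi$ alone, so passing
  -- from the coordinates of $E$ to those of $F$ preserves brackets.
  have hlie : ∀ y t y' t', ⁅e (y, t), e (y', t')⁆ = e (⁅y, y'⁆, ψ y y') := fun y t y' t' => by
    simp only [he, lie_add, add_lie, lie_smul, smul_lie, hE.incl_one_lie, hE.lie_incl_one,
      smul_zero, add_zero, hs.lie]
  have hlie' : ∀ y t y' t', ⁅e' (y, t), e' (y', t')⁆ = e' (⁅y, y'⁆, ψ y y') :=
    fun y t y' t' => by
      simp only [he', lie_add, add_lie, lie_smul, smul_lie, hF.incl_one_lie, hF.lie_incl_one,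
        smul_zero, add_zero, hs'.lie]
  let f : E.L ≃ₗ[ℝ] F.L := e.symm.trans e'
  have hf : ∀ p, f (e p) = e' p := fun p => congrArg e' (e.symm_apply_apply p)
  have hflie : ∀ x x', f ⁅x, x'⁆ = ⁅f x, f x'⁆ := by
    intro x x'
    obtain ⟨⟨y, t⟩, rfl⟩ := e.surjective x
    obtain ⟨⟨y', t'⟩, rfl⟩ := e.surjective x'
    rw [hlie, hf, hf, hf, hlie']
  refine ⟨{ f with map_lie' := fun {x x'} => hflie x x' }, fun x => ?_, fun t => ?_⟩
  · change F.proj (f x) = E.proj x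
    obtain ⟨⟨y, t⟩, rfl⟩ := e.surjective x
    rw [hf, he, he', map_add, map_add, map_smul, map_smul, hs.proj, hs'.proj,
      LieAlgebra.Extension.proj_incl, LieAlgebra.Extension.proj_incl, smul_zero]
  · change f (E.incl t) = F.incl t
    have h1 : E.incl t = e (0, t) := by rw [he, map_zero, zero_add, ← incl_eq_smul]
    have h2 : F.incl t = e' (0, t) := by rw [he', map_zero, zero_add, ← incl_eq_smul]
    rw [h1, h2, hf]

/-! ### The triviality criterion -/

/-- An extension is trivial if and only if some linear section has cocycle zero. -/
lemma isTrivial_iff : IsTrivial E ↔ ∃ s, Realizes E s 0 := by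
  constructor
  · rintro ⟨s, hs⟩
    exact ⟨s, hs, fun x y => by simp⟩
  · rintro ⟨s, hs⟩
    exact ⟨{ s with map_lie' := fun {x y} => by simpa using (hs.lie x y).symm }, hs.proj⟩

lemma HasCoeffs.isTrivial_iff {α : Fin N → ℝ} {β : Fin N → Fin N → ℝ} (hE : IsCentral E)
    (h : HasCoeffs E α β) :
    IsTrivial E ↔ (∀ k, ω k = 0 → α k = 0) ∧ ∀ k l, k < l → β k l = 0 := by
  obtain ⟨-, s, hs⟩ := h.exists_realizes hE
  rw [CK.isTrivial_iff]
  constructor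
  · rintro ⟨s', hs'⟩
    obtain ⟨f, hf⟩ : ∃ f : su ω → ℝ, ∀ x, s x = s' x + f x • E.incl 1 := by
      have : ∀ x, ∃ t : ℝ, s x - s' x = t • E.incl 1 := fun x =>
        exists_smul_of_proj_eq_zero E (by rw [map_sub, hs.proj, hs'.proj, sub_self])
      choose f hf using this
      exact ⟨f, fun x => by rw [← hf]; abel⟩
    -- Two sections differ by central elements, so lifts of $x$ and $y$ have the same bracket for
    -- both. For commuting $x,y$ this bracket is the cocycle value times $\Xi$, which the split
    -- section shows to be zero.
    have key : ∀ x y, ⁅x, y⁆ = 0 → stdForm ω α β x y = 0 := by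
      intro x y hxy
      have e1 := hs.lie x y
      have e2 := hs'.lie x y
      rw [hxy, map_zero, zero_add] at e1 e2
      apply smul_incl_one_injective E
      change stdForm ω α β x y • E.incl 1 = (0 : ℝ) • E.incl 1
      rw [← e1, hf x, hf y]
      simp [e2, hE.incl_one_lie, hE.lie_incl_one]
    refine ⟨fun k hk => ?_, fun k l hkl => ?_⟩
    · rw [← stdForm_suJ_suM_step (ω := ω) α β k]
      refine key _ _ ?_
      rw [suJ_lie_suM, omega_step, hk, mul_zero, zero_smul, neg_zero]
    · rw [← stdForm_suB_suB ω α β hkl]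
      exact key _ _ (suB_lie_suB ω k l)
  · rintro ⟨hα, hβ⟩
    -- The factor inverts $b_k([x,y])=-2\omega_kP_k(x,y)$, so the coboundary of $f$ is
    -- $\sum\alpha_kP_k$. When $\omega_k=0$, the hypothesis gives $\alpha_k=0$, and both terms
    -- vanish.
    set f : su ω →ₗ[ℝ] ℝ := ∑ k, (-(α k / (2 * ω k))) • (diagCoord k).comp (suIncl ω) with hf
    have e : stdForm ω α β - coboundary f = 0 := by
      refine LinearMap.ext fun x => LinearMap.ext fun y => ?_
      have h1 : ∀ k l : Fin N, (if k < l then β k l else 0) = 0 := fun k l => by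
        split_ifs with hkl
        exacts [hβ k l hkl, rfl]
      rw [LinearMap.sub_apply, LinearMap.sub_apply, LinearMap.zero_apply, LinearMap.zero_apply,
        sub_eq_zero, stdForm_apply, coboundary_apply, hf, LinearMap.sum_apply]
      simp only [h1, zero_mul, Finset.sum_const_zero, add_zero]
      refine Finset.sum_congr rfl fun k _ => ?_
      rw [LinearMap.smul_apply, LinearMap.comp_apply, suIncl_apply, diagCoord_coe_lie, smul_eq_mul]
      by_cases hk : ω k = 0
      · rw [hα k hk, hk]
        simp
      · field_simp
    exact ⟨_, e ▸ hs.add_smulRight hE f⟩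

end Extensions

end CK

end

theorem theorem4p1 {N : ℕ} (ω : Fin N → ℝ) :
    -- every central extension can be written with coefficients `α`, `β`, always admissible
    (∀ E : CK.Ext.{u} ω, CK.IsCentral E →
      (∃ (α : Fin N → ℝ) (β : Fin N → Fin N → ℝ), CK.HasCoeffs E α β) ∧
      ∀ (α : Fin N → ℝ) (β : Fin N → Fin N → ℝ), CK.HasCoeffs E α β → CK.Admissible ω β) ∧
    -- all admissible coefficients occur
    (∀ (α : Fin N → ℝ) (β : Fin N → Fin N → ℝ), CK.Admissible ω β →
      ∃ E : CK.Ext.{0} ω, CK.IsCentral E ∧ CK.HasCoeffs E α β) ∧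
    -- the coefficients determine the extension up to equivalence
    (∀ (E : CK.Ext.{u} ω) (F : CK.Ext.{v} ω) (α : Fin N → ℝ) (β : Fin N → Fin N → ℝ),
      CK.IsCentral E → CK.IsCentral F → CK.HasCoeffs E α β → CK.HasCoeffs F α β →
        CK.Equivalent E F) ∧
    -- triviality in general
    (∀ (E : CK.Ext.{u} ω) (α : Fin N → ℝ) (β : Fin N → Fin N → ℝ),
      CK.IsCentral E → CK.HasCoeffs E α β →
        (CK.IsTrivial E ↔ (∀ k, ω k = 0 → α k = 0) ∧ ∀ k l, k < l → β k l = 0)) ∧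
    -- a single nonzero coefficient `α_k`
    (∀ (E : CK.Ext.{u} ω) (k : Fin N) (c : ℝ), c ≠ 0 →
      CK.IsCentral E → CK.HasCoeffs E (Pi.single k c) 0 → (¬ CK.IsTrivial E ↔ ω k = 0)) ∧
    -- a nonzero coefficient `β_{kl}`
    (∀ (E : CK.Ext.{u} ω) (α : Fin N → ℝ) (β : Fin N → Fin N → ℝ) (k l : Fin N), k < l →
      β k l ≠ 0 → CK.IsCentral E → CK.HasCoeffs E α β →
        ω k = 0 ∧ ω l = 0 ∧ ¬ CK.IsTrivial E) := by
  refine ⟨fun E hE => ⟨hE.exists_hasCoeffs, fun α β h => (h.exists_realizes hE).1⟩,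
    fun α β hβ => ?_, fun E F α β hE hF hEc hFc => ?_,
    fun E α β hE h => h.isTrivial_iff hE, fun E k c hc hE h => ?_,
    fun E α β k l hkl hβ hE h => ?_⟩
  · obtain ⟨E, hE, s, hs⟩ := (CK.isCocycle_stdForm α hβ).exists_extension
    exact ⟨E, hE, hs.hasCoeffs⟩
  · obtain ⟨-, s, hs⟩ := hEc.exists_realizes hE
    obtain ⟨-, s', hs'⟩ := hFc.exists_realizes hF
    exact hs.equivalent hs' hE hF
  · rw [h.isTrivial_iff hE, ← not_iff_not, not_not]
    refine ⟨fun h0 hk => hc (by simpa using h0.1 k hk), fun hk => ⟨fun j hj => ?_, fun _ _ _ => rfl⟩⟩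
    have hjk : j ≠ k := fun h => hk (h ▸ hj)
    simp [hjk]
  · have had := (h.exists_realizes hE).1 k l hkl
    exact ⟨(mul_eq_zero.1 had.1).resolve_right hβ, (mul_eq_zero.1 had.2).resolve_right hβ,
      fun ht => hβ (((h.isTrivial_iff hE).1 ht).2 k l hkl)⟩
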